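/- For a Borel probability measure $\mu$ on $\mathbb{C}$ with compact support, let $I(\mu)=\iint -\log|z-w|\,d\mu(z)\,d\mu(w)\in(-\infty,+\infty]$ be its logarithmic energy, and for $E\subset\mathbb{C}$ let $\mathrm{Cap}(E)=\exp(-\inf_\mu I(\mu))$ be the logarithmic capacity, where the infimum is over all Borel probability measures $\mu$ whose support is a compact subset of $E$ (with $\inf\emptyset=+\infty$ and $e^{-\infty}=0$). **Theorem (Random phase transition).** Let $(c_k)$ be i.i.d. real random variables whose common distribution is absolutely continuous on $[0,1]$, with a density that is bounded and positive Lebesgue-almost everywhere on $[0,1]$. Let $\lambda>0$ and $\alpha>0$, let $I_k$ be the open interval with center $c_k$ and length $l_k=e^{-\lambda k^\alpha}$, and let $$S=\bigcap_{m}\bigcup_{k\ge m} I_k .$$ 1. If $0<\alpha\le 1$, then almost surely $\mathrm{Cap}(S)=\mathrm{Cap}([0,1])$, and $\mathrm{Cap}([0,1])>0$. 2. If $\alpha>1$, then $\mathrm{Cap}(S)=0$ (for every realization of the centers). -/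

import Mathlib

open MeasureTheory ProbabilityTheory Set
open scoped ENNReal

noncomputable section

/-- The logarithmic kernel `-log |z - w|`, with the value `+∞` on the diagonal. -/
def logKernel (z w : ℂ) : EReal :=
  -ENNReal.log (edist z w)

/-- The logarithmic energy `I(μ) = ∬ -log |z - w| dμ(z) dμ(w)`, as the integral of the positive
part of the kernel minus the integral of its negative part. For a finite measure with compact
support the second integral is finite, so that the difference is a well-defined element of
`(-∞, +∞]`. -/
def logEnergy (μ : Measure ℂ) : EReal :=
  ((∫⁻ w, ∫⁻ z, (logKernel z w).toENNReal ∂μ ∂μ : ℝ≥0∞) : EReal) -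
    ((∫⁻ w, ∫⁻ z, (-logKernel z w).toENNReal ∂μ ∂μ : ℝ≥0∞) : EReal)

/-- The logarithmic capacity `exp (-inf I(μ))`, the infimum being over the Borel probability
measures whose support is a compact subset of `E`; `exp (-∞) = 0`. -/
def logCapacity (E : Set ℂ) : ℝ≥0∞ :=
  EReal.exp (-sInf {e : EReal | ∃ μ : Measure ℂ, IsProbabilityMeasure μ ∧
    IsCompact μ.support ∧ μ.support ⊆ E ∧ e = logEnergy μ})

/-- The set `⋂ m, ⋃ k ≥ m, I k`, where `I k` is the open interval with center `c k` and
length `l k`. -/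
def limsupIntervals (c l : ℕ → ℝ) : Set ℝ :=
  ⋂ m : ℕ, ⋃ k ≥ m, Ioo (c k - l k / 2) (c k + l k / 2)

/-- The lengths `l_k = exp (-Λ k ^ α)`. -/
def expLength (Λ α : ℝ) (k : ℕ) : ℝ :=
  Real.exp (-Λ * (k : ℝ) ^ α)

end

/-!
A measure of finite energy has a finite potential almost everywhere, and the potential at a point
of `I_k` is at least about `log (1 / l_k) * μ (I_k)`. If `∑ 1 / log (1 / l_k)` converges, the
Borel–Cantelli lemma therefore shows that `μ` gives no mass to the limsup set, whose capacity is
then zero.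

If the series diverges, fix a step density `h` supported on `[0, 1)` and spread the mass of `h` over
dyadic cells contained in the random intervals of a long block of indices, the cell of generation
`m` being weighted by `1 / (m + 1)` because its self-energy is of order `m`. Distinct intervals are
independent, so the mean energy of the superposition is that of `h` plus diagonal terms, and the
latter become negligible because the total weight diverges. A second moment estimate and the second
Borel–Cantelli lemma then give, almost surely and simultaneously for the countably many step
densities, infinitely many blocks whose superposition has almost the energy of `h`. Iterating along
nested compact sets and passing to a weak limit produces a measure on the limsup set whose energy
is as close as desired to that of `[0, 1]`.
-/

section

open Filter Topology

@[fun_prop]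
theorem continuous_logKernel {X : Type*} [TopologicalSpace X] {f g : X → ℂ}
    (hf : Continuous f) (hg : Continuous g) : Continuous fun t => logKernel (f t) (g t) :=
  (ENNReal.continuous_log.comp (hf.edist hg)).neg

theorem logEnergy_map {X : Type*} [MeasurableSpace X] {μ : Measure X} [SFinite μ] {φ : X → ℂ}
    (hφ : Measurable φ) :
    logEnergy (μ.map φ) =
      ((∫⁻ y, ∫⁻ x, (logKernel (φ x) (φ y)).toENNReal ∂μ ∂μ : ℝ≥0∞) : EReal) -
        ((∫⁻ y, ∫⁻ x, (-logKernel (φ x) (φ y)).toENNReal ∂μ ∂μ : ℝ≥0∞) : EReal) := by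
  have lintegral_lintegral_map : ∀ F : ℂ × ℂ → ℝ≥0∞, Measurable F →
      ∫⁻ w, ∫⁻ z, F (z, w) ∂(μ.map φ) ∂(μ.map φ) = ∫⁻ y, ∫⁻ x, F (φ x, φ y) ∂μ ∂μ := by
    intro F hF
    rw [lintegral_map hF.lintegral_prod_left' hφ]
    exact lintegral_congr fun y => lintegral_map (by fun_prop) hφ
  have hK : Continuous fun p : ℂ × ℂ => logKernel p.1 p.2 := by fun_prop
  have hpos : Measurable fun p : ℂ × ℂ => (logKernel p.1 p.2).toENNReal :=
    hK.ereal_toENNReal.measurable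
  have hneg : Measurable fun p : ℂ × ℂ => (-logKernel p.1 p.2).toENNReal :=
    hK.neg.ereal_toENNReal.measurable
  rw [logEnergy, lintegral_lintegral_map _ hpos, lintegral_lintegral_map _ hneg]

theorem logKernel_nonneg_of_edist_le_one {z w : ℂ} (h : edist z w ≤ 1) : 0 ≤ logKernel z w :=
  EReal.neg_nonneg.2 (by simpa using h)

theorem lintegral_neg_logKernel_ne_top {μ : Measure ℂ} [IsFiniteMeasure μ]
    (hμ : Bornology.IsBounded μ.support) :
    ∫⁻ w, ∫⁻ z, (-logKernel z w).toENNReal ∂μ ∂μ ≠ ⊤ := by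
  set C : ℝ≥0∞ := (ENNReal.log (Metric.ediam μ.support)).toENNReal
  have hC : C ≠ ⊤ := by
    rw [EReal.toENNReal_ne_top_iff, Ne, ENNReal.log_eq_top_iff]
    exact hμ.ediam_ne_top
  have hkernel : ∀ z ∈ μ.support, ∀ w ∈ μ.support, (-logKernel z w).toENNReal ≤ C := by
    intro z hz w hw
    refine EReal.toENNReal_le_toENNReal ?_
    rw [logKernel, neg_neg]
    exact ENNReal.log_le_log (Metric.edist_le_ediam_of_mem hz hw)
  have hsupp : ∀ᵐ z ∂μ, z ∈ μ.support := Measure.support_mem_ae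
  refine ne_top_of_le_ne_top (b := ∫⁻ _, ∫⁻ _, C ∂μ ∂μ) ?_ ?_
  · simp only [lintegral_const]
    finiteness
  · refine lintegral_mono_ae ?_
    filter_upwards [hsupp] with w hw
    refine lintegral_mono_ae ?_
    filter_upwards [hsupp] with z hz using hkernel z hz w hw

theorem lintegral_logKernel_ne_top {μ : Measure ℂ} [IsFiniteMeasure μ]
    (hμ : Bornology.IsBounded μ.support) (henergy : logEnergy μ ≠ ⊤) :
    ∫⁻ w, ∫⁻ z, (logKernel z w).toENNReal ∂μ ∂μ ≠ ⊤ := by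
  contrapose henergy
  lift ∫⁻ w, ∫⁻ z, (-logKernel z w).toENNReal ∂μ ∂μ to NNReal
    using lintegral_neg_logKernel_ne_top hμ with b hb
  rw [logEnergy, henergy, ← hb, EReal.coe_ennreal_top, sub_eq_add_neg]
  refine EReal.top_add_of_ne_bot ?_
  rw [Ne, EReal.neg_eq_bot_iff]
  simp

/-! ### The upper bound on the energy: sets of capacity zero -/

theorem logCapacity_mono {E F : Set ℂ} (h : E ⊆ F) : logCapacity E ≤ logCapacity F := by
  unfold logCapacity
  rw [EReal.exp_le_exp_iff, EReal.neg_le_neg_iff]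
  refine sInf_le_sInf ?_
  rintro e ⟨μ, hμ, hcompact, hsub, he⟩
  exact ⟨μ, hμ, hcompact, hsub.trans h, he⟩

theorem ae_eventually_notMem_of_mul_measure_le {X : Type*} [MeasurableSpace X] {μ : Measure X}
    {p : X → ℝ≥0∞} (hp : ∀ᵐ x ∂μ, p x ≠ ⊤) {J : ℕ → Set X} {d : ℕ → ℝ≥0∞}
    (hJ : ∀ k, ∀ x ∈ J k, d k * μ (J k) ≤ p x) (hd : ∑' k, (d k)⁻¹ ≠ ⊤) :
    ∀ᵐ x ∂μ, ∀ᶠ k in atTop, x ∉ J k := by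
  have hbdd : ∀ M : ℕ, ∀ᵐ x ∂μ, ∀ᶠ k in atTop, x ∉ {x | p x ≤ M} ∩ J k := by
    intro M
    have hle : ∀ k, μ ({x | p x ≤ M} ∩ J k) ≤ M * (d k)⁻¹ := by
      intro k
      obtain h | ⟨x, hxM, hxJ⟩ := ({x | p x ≤ M} ∩ J k).eq_empty_or_nonempty
      · simp [h]
      have hd0 : d k ≠ 0 := ENNReal.inv_ne_top.1 (ENNReal.ne_top_of_tsum_ne_top hd k)
      refine (measure_mono inter_subset_right).trans ?_
      rw [← div_eq_mul_inv, ENNReal.le_div_iff_mul_le (.inl hd0) (.inr (by finiteness)), mul_comm]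
      exact (hJ k x hxJ).trans hxM
    refine ae_eventually_notMem (ne_top_of_le_ne_top ?_ (ENNReal.tsum_le_tsum hle))
    rw [ENNReal.tsum_mul_left]
    finiteness
  filter_upwards [hp, ae_all_iff.2 hbdd] with x hx hxM
  obtain ⟨M, hM⟩ := ENNReal.exists_nat_gt hx
  filter_upwards [hxM M] with k hk hxJ using hk ⟨hM.le, hxJ⟩

/- A measure `μ` of finite energy has an almost everywhere finite potential `p`. On `J k` the
potential is at least `d k * μ (J k)`, so on `{p ≤ M}` the Borel–Cantelli lemma applies. -/
theorem logCapacity_eq_zero_of_frequently {E : Set ℂ} {J : ℕ → Set ℂ}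
    (hE : ∀ z ∈ E, ∃ᶠ k in atTop, z ∈ J k) (hJ : ∀ k, MeasurableSet (J k)) {d : ℕ → ℝ≥0∞}
    (hd : ∀ k, ∀ z ∈ J k, ∀ w ∈ J k, d k ≤ (logKernel z w).toENNReal)
    (hsum : ∑' k, (d k)⁻¹ ≠ ⊤) : logCapacity E = 0 := by
  rw [logCapacity, EReal.exp_eq_zero_iff, EReal.neg_eq_bot_iff, sInf_eq_top]
  rintro e ⟨μ, hμ, hcompact, hsub, rfl⟩
  by_contra henergy
  have hK : Continuous fun p : ℂ × ℂ => logKernel p.1 p.2 := by fun_prop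
  have hpotential : ∀ᵐ w ∂μ, ∫⁻ z, (logKernel z w).toENNReal ∂μ ≠ ⊤ := by
    filter_upwards [ae_lt_top hK.ereal_toENNReal.measurable.lintegral_prod_left'
      (lintegral_logKernel_ne_top hcompact.isBounded henergy)] with w hw using hw.ne
  have hmass : ∀ k, ∀ w ∈ J k, d k * μ (J k) ≤ ∫⁻ z, (logKernel z w).toENNReal ∂μ := by
    intro k w hw
    calc d k * μ (J k) = ∫⁻ _ in J k, d k ∂μ := (setLIntegral_const _ _).symm
      _ ≤ ∫⁻ z in J k, (logKernel z w).toENNReal ∂μ :=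
        setLIntegral_mono' (hJ k) fun z hz => hd k z hz w hw
      _ ≤ ∫⁻ z, (logKernel z w).toENNReal ∂μ := setLIntegral_le_lintegral _ _
  have hfalse : ∀ᵐ _ ∂μ, False := by
    filter_upwards [ae_eventually_notMem_of_mul_measure_le hpotential hmass hsum,
      Measure.support_mem_ae] with w hw hsupp
    exact hE w (hsub hsupp) hw
  simp [NeZero.ne μ] at hfalse

theorem frequently_mem_Ioo_of_mem_limsupIntervals {c l : ℕ → ℝ} {x : ℝ}
    (hx : x ∈ limsupIntervals c l) :
    ∃ᶠ k in atTop, x ∈ Ioo (c k - l k / 2) (c k + l k / 2) :=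
  frequently_atTop.2 fun m => by simpa only [mem_iUnion₂, exists_prop] using mem_iInter.1 hx m

theorem ofReal_neg_log_le_logKernel {a r x y : ℝ} (hx : x ∈ Ioo (a - r / 2) (a + r / 2))
    (hy : y ∈ Ioo (a - r / 2) (a + r / 2)) :
    ENNReal.ofReal (-Real.log r) ≤ (logKernel (x : ℂ) (y : ℂ)).toENNReal := by
  have hr : 0 < r := by linarith [hx.1, hx.2]
  have hedist : edist (x : ℂ) (y : ℂ) ≤ ENNReal.ofReal r := by
    rw [Complex.isometry_ofReal.edist_eq, edist_dist, Real.dist_eq]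
    refine ENNReal.ofReal_le_ofReal (abs_le.2 ⟨?_, ?_⟩) <;> linarith [hx.1, hx.2, hy.1, hy.2]
  rw [← EReal.real_coe_toENNReal]
  refine EReal.toENNReal_le_toENNReal ?_
  rw [logKernel, EReal.coe_neg, ← ENNReal.log_ofReal_of_pos hr]
  exact EReal.neg_le_neg_iff.2 (ENNReal.log_le_log hedist)

theorem logCapacity_limsupIntervals_eq_zero {l : ℕ → ℝ} (hl_pos : ∀ k, 0 < l k)
    (hl : Tendsto l atTop (𝓝 0)) (hsum : Summable fun k => (Real.log (l k))⁻¹) (c : ℕ → ℝ) :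
    logCapacity (((↑) : ℝ → ℂ) '' limsupIntervals c l) = 0 := by
  obtain ⟨N, hN⟩ := eventually_atTop.1 (hl.eventually_lt_const one_pos)
  have hlog : ∀ k, 0 < -Real.log (l (k + N)) := fun k =>
    neg_pos.2 (Real.log_neg (hl_pos _) (hN _ (Nat.le_add_left N k)))
  refine logCapacity_eq_zero_of_frequently (d := fun k => ENNReal.ofReal (-Real.log (l (k + N))))
    (J := fun k => ((↑) : ℝ → ℂ) ''
      Ioo (c (k + N) - l (k + N) / 2) (c (k + N) + l (k + N) / 2)) ?_ ?_ ?_ ?_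
  · rintro _ ⟨x, hx, rfl⟩
    refine (tendsto_sub_atTop_nat N).frequently ?_
    refine ((frequently_mem_Ioo_of_mem_limsupIntervals hx).and_eventually
      (eventually_ge_atTop N)).mono ?_
    rintro k ⟨hk, hNk⟩
    rw [Nat.sub_add_cancel hNk]
    exact mem_image_of_mem _ hk
  · have hcoe : MeasurableEmbedding ((↑) : ℝ → ℂ) :=
      Complex.isometry_ofReal.isClosedEmbedding.measurableEmbedding
    exact fun k => hcoe.measurableSet_image.2 measurableSet_Ioo
  · rintro k _ ⟨x, hx, rfl⟩ _ ⟨y, hy, rfl⟩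
    exact ofReal_neg_log_le_logKernel hx hy
  · have hterm : ∀ k, (ENNReal.ofReal (-Real.log (l (k + N))))⁻¹ =
        ENNReal.ofReal (-(Real.log (l (k + N)))⁻¹) := fun k => by
      rw [← ENNReal.ofReal_inv_of_pos (hlog k), inv_neg]
    simp_rw [hterm]
    exact ((summable_nat_add_iff N).2 hsum).neg.tsum_ofReal_ne_top

/-! ### The kernel on the line and the energy of densities -/

/-- The positive part of the logarithmic kernel on the real line; on `[0, 1]` it is the kernel
itself. -/
noncomputable def realKernel (x y : ℝ) : ℝ≥0∞ :=
  (logKernel (x : ℂ) (y : ℂ)).toENNReal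

@[fun_prop]
theorem continuous_realKernel {X : Type*} [TopologicalSpace X] {f g : X → ℝ}
    (hf : Continuous f) (hg : Continuous g) : Continuous fun t => realKernel (f t) (g t) :=
  Continuous.ereal_toENNReal (by fun_prop)

theorem realKernel_self (x : ℝ) : realKernel x x = ⊤ := by
  simp [realKernel, logKernel]

theorem realKernel_of_ne {x y : ℝ} (h : x ≠ y) :
    realKernel x y = ENNReal.ofReal (-Real.log |x - y|) := by
  rw [realKernel, logKernel, Complex.isometry_ofReal.edist_eq, edist_dist, Real.dist_eq,
    ENNReal.log_ofReal_of_pos (abs_pos.2 (sub_ne_zero.2 h)), ← EReal.coe_neg,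
    EReal.real_coe_toENNReal]

/-- The mutual energy of the measures on the line with densities `u` and `v`. -/
noncomputable def mutualEnergy (u v : ℝ → ℝ≥0∞) : ℝ≥0∞ :=
  ∫⁻ x, ∫⁻ y, realKernel x y * (u x * v y)

theorem mutualEnergy_eq_lintegral_prod {u v : ℝ → ℝ≥0∞} (hu : Measurable u) (hv : Measurable v) :
    mutualEnergy u v = ∫⁻ q : ℝ × ℝ, realKernel q.1 q.2 * (u q.1 * v q.2)
      ∂(volume.prod volume) := by
  rw [lintegral_prod _ (by fun_prop)]
  rfl

theorem mutualEnergy_mono {u u' v v' : ℝ → ℝ≥0∞} (hu : u ≤ u') (hv : v ≤ v') :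
    mutualEnergy u v ≤ mutualEnergy u' v' :=
  lintegral_mono fun x => lintegral_mono fun y => by gcongr; exacts [hu x, hv y]

theorem mutualEnergy_const_mul {a b : ℝ≥0∞} (ha : a ≠ ⊤) (hb : b ≠ ⊤) (u v : ℝ → ℝ≥0∞) :
    mutualEnergy (fun x => a * u x) (fun y => b * v y) = a * b * mutualEnergy u v := by
  simp_rw [mutualEnergy, mul_mul_mul_comm a, mul_left_comm (realKernel _ _) (a * b)]
  simp only [lintegral_const_mul' (a * b) _ (by finiteness)]

theorem mutualEnergy_sum {ι κ : Type*} {s : Finset ι} {t : Finset κ} {u : ι → ℝ → ℝ≥0∞}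
    {v : κ → ℝ → ℝ≥0∞} (hu : ∀ i ∈ s, Measurable (u i)) (hv : ∀ j ∈ t, Measurable (v j)) :
    mutualEnergy (fun x => ∑ i ∈ s, u i x) (fun y => ∑ j ∈ t, v j y) =
      ∑ i ∈ s, ∑ j ∈ t, mutualEnergy (u i) (v j) := by
  have hmeas : ∀ i ∈ s, ∀ j ∈ t,
      Measurable fun p : ℝ × ℝ => realKernel p.1 p.2 * (u i p.1 * v j p.2) := by
    intro i hi j hj
    have := hu i hi
    have := hv j hj
    fun_prop
  have hslice : ∀ x, ∀ i ∈ s, ∀ j ∈ t, Measurable fun y => realKernel x y * (u i x * v j y) :=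
    fun x i _ j hj => by have := hv j hj; fun_prop
  calc mutualEnergy (fun x => ∑ i ∈ s, u i x) (fun y => ∑ j ∈ t, v j y)
      = ∫⁻ x, ∑ i ∈ s, ∑ j ∈ t, ∫⁻ y, realKernel x y * (u i x * v j y) := by
        refine lintegral_congr fun x => ?_
        simp_rw [Finset.sum_mul_sum, Finset.mul_sum]
        rw [lintegral_finsetSum s fun i hi => Finset.measurable_fun_sum t (hslice x i hi)]
        exact Finset.sum_congr rfl fun i hi => lintegral_finsetSum t (hslice x i hi)
    _ = ∑ i ∈ s, ∑ j ∈ t, mutualEnergy (u i) (v j) := by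
        rw [lintegral_finsetSum s fun i hi => Finset.measurable_fun_sum t fun j hj =>
          Measurable.lintegral_prod_right' (hmeas i hi j hj)]
        exact Finset.sum_congr rfl fun i hi => lintegral_finsetSum t fun j hj =>
          Measurable.lintegral_prod_right' (hmeas i hi j hj)

theorem mutualEnergy_le_of_forall {u v : ℝ → ℝ≥0∞} (hu : Measurable u) (hv : Measurable v)
    {C : ℝ≥0∞} (h : ∀ x y, u x ≠ 0 → v y ≠ 0 → realKernel x y ≤ C) :
    mutualEnergy u v ≤ C * ((∫⁻ x, u x) * ∫⁻ y, v y) := by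
  rw [← lintegral_lintegral_mul hu.aemeasurable hv.aemeasurable,
    ← lintegral_const_mul _ (by fun_prop)]
  refine lintegral_mono fun x => ?_
  rw [← lintegral_const_mul _ (by fun_prop)]
  refine lintegral_mono fun y => ?_
  by_cases hx : u x = 0
  · simp [hx]
  by_cases hy : v y = 0
  · simp [hy]
  gcongr
  exact h x y hx hy

theorem measurable_mutualEnergy {X : Type*} [MeasurableSpace X] {U V : X → ℝ → ℝ≥0∞}
    (hU : Measurable (Function.uncurry U)) (hV : Measurable (Function.uncurry V)) :
    Measurable fun a => mutualEnergy (U a) (V a) := by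
  have hUz := hU.comp (f := fun z : (X × ℝ) × ℝ => (z.1.1, z.1.2)) (by fun_prop)
  have hVz := hV.comp (f := fun z : (X × ℝ) × ℝ => (z.1.1, z.2)) (by fun_prop)
  have hF : Measurable fun z : (X × ℝ) × ℝ =>
      realKernel z.1.2 z.2 * (U z.1.1 z.1.2 * V z.1.1 z.2) :=
    Measurable.mul (by fun_prop) (hUz.mul hVz)
  exact hF.lintegral_prod_right'.lintegral_prod_right'

theorem lintegral_lintegral_mutualEnergy {X Y : Type*} [MeasurableSpace X] [MeasurableSpace Y]
    {μ : Measure X} {ν : Measure Y} [SFinite μ] [SFinite ν] {U : X → ℝ → ℝ≥0∞} {V : Y → ℝ → ℝ≥0∞}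
    (hU : Measurable (Function.uncurry U)) (hV : Measurable (Function.uncurry V)) :
    ∫⁻ a, ∫⁻ b, mutualEnergy (U a) (V b) ∂ν ∂μ =
      mutualEnergy (fun x => ∫⁻ a, U a x ∂μ) (fun y => ∫⁻ b, V b y ∂ν) := by
  have hF : Measurable fun z : (ℝ × ℝ) × (X × Y) =>
      realKernel z.1.1 z.1.2 * (U z.2.1 z.1.1 * V z.2.2 z.1.2) := by
    have hUz := hU.comp (f := fun z : (ℝ × ℝ) × (X × Y) => (z.2.1, z.1.1)) (by fun_prop)
    have hVz := hV.comp (f := fun z : (ℝ × ℝ) × (X × Y) => (z.2.2, z.1.2)) (by fun_prop)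
    exact Measurable.mul (by fun_prop) (hUz.mul hVz)
  calc ∫⁻ a, ∫⁻ b, mutualEnergy (U a) (V b) ∂ν ∂μ
      = ∫⁻ p : X × Y, ∫⁻ q : ℝ × ℝ, realKernel q.1 q.2 * (U p.1 q.1 * V p.2 q.2)
          ∂(volume.prod volume) ∂(μ.prod ν) := by
        rw [lintegral_prod _ (hF.lintegral_prod_left' (μ := volume.prod volume)).aemeasurable]
        exact lintegral_congr fun a => lintegral_congr fun b =>
          mutualEnergy_eq_lintegral_prod hU.of_uncurry_left hV.of_uncurry_left
    _ = ∫⁻ q : ℝ × ℝ, ∫⁻ p : X × Y, realKernel q.1 q.2 * (U p.1 q.1 * V p.2 q.2)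
          ∂(μ.prod ν) ∂(volume.prod volume) :=
        lintegral_lintegral_swap (hF.comp measurable_swap).aemeasurable
    _ = ∫⁻ q : ℝ × ℝ, realKernel q.1 q.2 * ((∫⁻ a, U a q.1 ∂μ) * ∫⁻ b, V b q.2 ∂ν)
          ∂(volume.prod volume) := by
        refine lintegral_congr fun q => ?_
        have hUq : Measurable fun a => U a q.1 := hU.comp measurable_prodMk_right
        have hVq : Measurable fun b => V b q.2 := hV.comp measurable_prodMk_right
        rw [lintegral_const_mul _ (by fun_prop),
          lintegral_prod_mul hUq.aemeasurable hVq.aemeasurable]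
    _ = mutualEnergy (fun x => ∫⁻ a, U a x ∂μ) (fun y => ∫⁻ b, V b y ∂ν) := by
        exact (mutualEnergy_eq_lintegral_prod hU.lintegral_prod_left hV.lintegral_prod_left).symm

/-- The energy of a measure on the line, with respect to `realKernel`. -/
noncomputable def realEnergy (μ : Measure ℝ) : ℝ≥0∞ :=
  ∫⁻ y, ∫⁻ x, realKernel x y ∂μ ∂μ

theorem realEnergy_eq_lintegral_prod (μ : Measure ℝ) [SFinite μ] :
    realEnergy μ = ∫⁻ p, realKernel p.1 p.2 ∂(μ.prod μ) := by
  rw [lintegral_prod_symm _ (by fun_prop)]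
  rfl

theorem logEnergy_map_ofReal {μ : Measure ℝ} [SFinite μ] (hμ : ∀ᵐ x ∂μ, x ∈ Icc (0 : ℝ) 1) :
    logEnergy (μ.map ((↑) : ℝ → ℂ)) = realEnergy μ := by
  have hneg : ∀ᵐ (y : ℝ) ∂μ, ∫⁻ x : ℝ, (-logKernel (x : ℂ) (y : ℂ)).toENNReal ∂μ = 0 := by
    filter_upwards [hμ] with y hy
    rw [lintegral_eq_zero_of_ae_eq_zero]
    filter_upwards [hμ] with x hx
    refine EReal.toENNReal_of_nonpos (EReal.neg_le_zero.2 (logKernel_nonneg_of_edist_le_one ?_))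
    rw [Complex.isometry_ofReal.edist_eq, edist_dist]
    exact ENNReal.ofReal_le_one.2 (Real.dist_le_of_mem_Icc_01 hx hy)
  rw [logEnergy_map Complex.measurable_ofReal, lintegral_eq_zero_of_ae_eq_zero hneg]
  simp [realEnergy, realKernel]

theorem measure_singleton_eq_zero_of_realEnergy_ne_top {μ : Measure ℝ} (h : realEnergy μ ≠ ⊤)
    (x : ℝ) : μ {x} = 0 := by
  contrapose! h
  refine top_le_iff.1 ?_
  calc (⊤ : ℝ≥0∞) = ∫⁻ y in {x}, ∫⁻ z in {x}, realKernel z y ∂μ ∂μ := by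
        simp [realKernel_self, h]
    _ ≤ ∫⁻ y in {x}, ∫⁻ z, realKernel z y ∂μ ∂μ :=
        lintegral_mono fun y => setLIntegral_le_lintegral _ _
    _ ≤ realEnergy μ := setLIntegral_le_lintegral _ _

/-! ### Dyadic cells -/

/-- The index `i` of the cell `[i / 2 ^ m, (i + 1) / 2 ^ m)` of generation `m` that contains
`x`. -/
noncomputable def dyadicIndex (m : ℕ) (x : ℝ) : ℤ :=
  ⌊(2 : ℝ) ^ m * x⌋

@[fun_prop]
theorem measurable_dyadicIndex (m : ℕ) : Measurable (dyadicIndex m) :=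
  Int.measurable_floor.comp (measurable_const_mul _)

theorem dyadicIndex_eq_iff {m : ℕ} {x : ℝ} {i : ℤ} :
    dyadicIndex m x = i ↔ x ∈ Ico ((i : ℝ) / 2 ^ m) ((i + 1 : ℝ) / 2 ^ m) := by
  have h : (0 : ℝ) < 2 ^ m := by positivity
  rw [dyadicIndex, Int.floor_eq_iff, mem_Ico, div_le_iff₀ h, lt_div_iff₀ h, mul_comm x]

theorem dyadicIndex_zero_eq_zero_iff {x : ℝ} : dyadicIndex 0 x = 0 ↔ x ∈ Ico (0 : ℝ) 1 := by
  simp [dyadicIndex_eq_iff]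

theorem dyadicIndex_eq_of_le {r m : ℕ} (hrm : r ≤ m) {x y : ℝ}
    (h : dyadicIndex m x = dyadicIndex m y) : dyadicIndex r x = dyadicIndex r y := by
  obtain ⟨d, rfl⟩ := Nat.exists_eq_add_of_le hrm
  have hdiv : ∀ z, dyadicIndex r z = dyadicIndex (r + d) z / ((2 ^ d : ℕ) : ℤ) := by
    intro z
    rw [dyadicIndex, dyadicIndex, ← Int.floor_div_natCast]
    congr 1
    push_cast
    field_simp
    ring
  rw [hdiv, hdiv, h]

theorem abs_sub_lt_of_dyadicIndex_eq {m : ℕ} {x y : ℝ} (h : dyadicIndex m x = dyadicIndex m y) :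
    |x - y| < (1 / 2) ^ m := by
  have h2 : (0 : ℝ) < 2 ^ m := by positivity
  have hlt := Int.abs_sub_lt_one_of_floor_eq_floor h
  rw [← mul_sub, abs_mul, abs_of_pos h2] at hlt
  rwa [one_div_pow, lt_div_iff₀' h2]

/-- The density, as a function of `x`, of the uniform distribution on the dyadic cell of
generation `m` that contains `s`. -/
noncomputable def cellDensity (m : ℕ) (s x : ℝ) : ℝ≥0∞ :=
  if dyadicIndex m s = dyadicIndex m x then 2 ^ m else 0

theorem cellDensity_comm (m : ℕ) (s x : ℝ) : cellDensity m s x = cellDensity m x s := by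
  simp only [cellDensity, eq_comm]

@[fun_prop]
theorem measurable_cellDensity {X : Type*} [MeasurableSpace X] (m : ℕ) {f g : X → ℝ}
    (hf : Measurable f) (hg : Measurable g) : Measurable fun t => cellDensity m (f t) (g t) :=
  Measurable.ite (measurableSet_eq_fun (by fun_prop) (by fun_prop)) measurable_const
    measurable_const

theorem cellDensity_le (m : ℕ) (s x : ℝ) : cellDensity m s x ≤ 2 ^ m := by
  unfold cellDensity
  split_ifs <;> simp

theorem cellDensity_ne_top (m : ℕ) (s x : ℝ) : cellDensity m s x ≠ ⊤ :=
  ne_top_of_le_ne_top (by finiteness) (cellDensity_le m s x)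

theorem dyadicIndex_eq_of_cellDensity_ne_zero {m : ℕ} {s x : ℝ} (h : cellDensity m s x ≠ 0) :
    dyadicIndex m s = dyadicIndex m x := by
  by_contra hne
  exact h (if_neg hne)

theorem cellDensity_zero_zero : cellDensity 0 0 = (Ico (0 : ℝ) 1).indicator 1 := by
  ext x
  have h0 : dyadicIndex 0 0 = 0 := dyadicIndex_zero_eq_zero_iff.2 ⟨le_rfl, one_pos⟩
  simp only [cellDensity, h0, eq_comm (a := (0 : ℤ)), dyadicIndex_zero_eq_zero_iff, pow_zero,
    indicator_apply, Pi.one_apply]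

theorem cellDensity_le_mul_cellDensity_zero {s : ℝ} (hs : s ∈ Ico (0 : ℝ) 1) (m : ℕ) (x : ℝ) :
    cellDensity m s x ≤ 2 ^ m * cellDensity 0 0 x := by
  by_cases h : cellDensity m s x = 0
  · simp [h]
  have hx := dyadicIndex_eq_of_le m.zero_le (dyadicIndex_eq_of_cellDensity_ne_zero h)
  rw [dyadicIndex_zero_eq_zero_iff.2 hs, eq_comm, dyadicIndex_zero_eq_zero_iff] at hx
  simpa [cellDensity_zero_zero, hx] using cellDensity_le m s x

theorem lintegral_cellDensity (m : ℕ) (s : ℝ) : ∫⁻ x, cellDensity m s x = 1 := by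
  have h : (0 : ℝ) < 2 ^ m := by positivity
  have hind : cellDensity m s = (Ico ((dyadicIndex m s : ℝ) / 2 ^ m)
      ((dyadicIndex m s + 1 : ℝ) / 2 ^ m)).indicator fun _ => 2 ^ m := by
    ext x
    simp only [cellDensity, indicator_apply, ← dyadicIndex_eq_iff, eq_comm]
  rw [hind, lintegral_indicator_const measurableSet_Ico, Real.volume_Ico, ← sub_div,
    add_sub_cancel_left, one_div, ENNReal.ofReal_inv_of_pos h, ENNReal.ofReal_pow (by norm_num)]
  simpa using ENNReal.mul_inv_cancel (a := (2 : ℝ≥0∞) ^ m) (by simp) (by finiteness)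

theorem lintegral_cellDensity_mul_eq {m : ℕ} {h : ℝ → ℝ≥0∞}
    (hm : ∀ x y, dyadicIndex m x = dyadicIndex m y → h x = h y) (s : ℝ) :
    ∫⁻ x, cellDensity m s x * h x = h s := by
  have hmul : ∀ x, cellDensity m s x * h x = cellDensity m s x * h s := by
    intro x
    by_cases hx : cellDensity m s x = 0
    · simp [hx]
    · rw [hm _ _ (dyadicIndex_eq_of_cellDensity_ne_zero hx)]
  simp_rw [hmul]
  rw [lintegral_mul_const _ (by fun_prop), lintegral_cellDensity, one_mul]

theorem lintegral_ofReal_neg_log_le : ∫⁻ t : ℝ, ENNReal.ofReal (-Real.log t) ≤ 2 := by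
  have hsupp : (fun t : ℝ => ENNReal.ofReal (-Real.log t)).support ⊆ Ioc (-1 : ℝ) 1 := by
    intro t ht
    have hlog : Real.log |t| < 0 := by
      simpa only [Function.mem_support, Ne, ENNReal.ofReal_eq_zero, not_le, neg_pos,
        ← Real.log_abs t] using ht
    by_contra hmem
    refine hlog.not_ge (Real.log_nonneg (not_lt.1 fun h => hmem ?_))
    exact ⟨(abs_lt.1 h).1, (abs_lt.1 h).2.le⟩
  have hint : IntervalIntegrable (fun t => -Real.log t) volume (-1) 1 :=
    intervalIntegral.intervalIntegrable_log'.neg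
  have hpos : 0 ≤ᵐ[volume.restrict (Ioc (-1 : ℝ) 1)] fun t => -Real.log t := by
    refine (ae_restrict_iff' measurableSet_Ioc).2 (Eventually.of_forall fun t ht => ?_)
    rw [Pi.zero_apply, neg_nonneg, ← Real.log_abs]
    exact Real.log_nonpos (abs_nonneg t) (abs_le.2 ⟨ht.1.le, ht.2⟩)
  rw [← setLIntegral_eq_of_support_subset hsupp, ← ofReal_integral_eq_lintegral_ofReal
    ((intervalIntegrable_iff_integrableOn_Ioc_of_le (by norm_num)).1 hint) hpos,
    ← intervalIntegral.integral_of_le (by norm_num), intervalIntegral.integral_neg, integral_log]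
  norm_num

theorem lintegral_ofReal_neg_log_mul_sub_le {a : ℝ} (ha : 0 < a) (x : ℝ) :
    ∫⁻ y, ENNReal.ofReal a * ENNReal.ofReal (-Real.log (a * (x - y))) ≤ 2 := by
  rw [lintegral_const_mul' _ _ ENNReal.ofReal_ne_top,
    lintegral_sub_left_eq_self (fun t => ENNReal.ofReal (-Real.log (a * t))) x,
    ← lintegral_map (μ := volume) (f := fun t => ENNReal.ofReal (-Real.log t))
      (g := fun t => a * t) (by fun_prop) (measurable_const_mul _),
    Real.map_volume_mul_left ha.ne', lintegral_smul_measure, abs_of_pos (inv_pos.2 ha),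
    smul_eq_mul, ← mul_assoc, ← ENNReal.ofReal_mul ha.le, mul_inv_cancel₀ ha.ne',
    ENNReal.ofReal_one, one_mul]
  exact lintegral_ofReal_neg_log_le

theorem lintegral_realKernel_mul_cellDensity_le (m : ℕ) (s x : ℝ) :
    ∫⁻ y, realKernel x y * cellDensity m s y ≤ ENNReal.ofReal (m * Real.log 2) + 2 := by
  have h2 : (0 : ℝ) < 2 ^ m := by positivity
  have hpoint : ∀ᵐ y, realKernel x y * cellDensity m s y ≤
      ENNReal.ofReal (m * Real.log 2) * cellDensity m s y +
        ENNReal.ofReal (2 ^ m) * ENNReal.ofReal (-Real.log (2 ^ m * (x - y))) := by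
    filter_upwards [compl_mem_ae_iff.2 (measure_singleton x)] with y hy
    have hxy : x ≠ y := Ne.symm hy
    have hlog : -Real.log |x - y| = m * Real.log 2 + -Real.log (2 ^ m * (x - y)) := by
      rw [Real.log_mul h2.ne' (sub_ne_zero.2 hxy), Real.log_pow, Real.log_abs]
      ring
    rw [realKernel_of_ne hxy, hlog]
    refine (mul_le_mul_left ENNReal.ofReal_add_le _).trans ?_
    rw [add_mul, mul_comm (ENNReal.ofReal (2 ^ m))]
    gcongr
    simpa using cellDensity_le m s y
  refine (lintegral_mono_ae hpoint).trans ?_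
  rw [lintegral_add_left (by fun_prop), lintegral_const_mul _ (by fun_prop),
    lintegral_cellDensity, mul_one]
  gcongr
  exact lintegral_ofReal_neg_log_mul_sub_le h2 x

theorem mutualEnergy_cellDensity_le (m : ℕ) (s t : ℝ) :
    mutualEnergy (cellDensity m s) (cellDensity m t) ≤ ENNReal.ofReal (m * Real.log 2) + 2 :=
  calc mutualEnergy (cellDensity m s) (cellDensity m t)
      = ∫⁻ x, cellDensity m s x * ∫⁻ y, realKernel x y * cellDensity m t y := by
        refine lintegral_congr fun x => ?_
        simp only [mul_left_comm (realKernel x _)]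
        exact lintegral_const_mul' _ _ (cellDensity_ne_top m s x)
    _ ≤ ∫⁻ x, cellDensity m s x * (ENNReal.ofReal (m * Real.log 2) + 2) := by
        gcongr with x
        exact lintegral_realKernel_mul_cellDensity_le m t x
    _ = ENNReal.ofReal (m * Real.log 2) + 2 := by
        rw [lintegral_mul_const _ (by fun_prop), lintegral_cellDensity, one_mul]

theorem mutualEnergy_cellDensity_le_two_mul (m : ℕ) (s t : ℝ) :
    mutualEnergy (cellDensity m s) (cellDensity m t) ≤ 2 * (m + 1) := by
  refine (mutualEnergy_cellDensity_le m s t).trans ?_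
  rw [mul_add, mul_one]
  gcongr
  have hm : (m : ℝ) * Real.log 2 ≤ ((2 * m : ℕ) : ℝ) := by
    push_cast
    nlinarith [Real.log_two_lt_d9, m.cast_nonneg (α := ℝ)]
  simpa using ENNReal.ofReal_le_ofReal hm

theorem mutualEnergy_cellDensity_le_of_forall {m : ℕ} {s t : ℝ} {C : ℝ≥0∞}
    (h : ∀ x y, |s - x| < (1 / 2) ^ m → |t - y| < (1 / 2) ^ m → realKernel x y ≤ C) :
    mutualEnergy (cellDensity m s) (cellDensity m t) ≤ C := by
  refine (mutualEnergy_le_of_forall (by fun_prop) (by fun_prop) fun x y hx hy => h x y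
    (abs_sub_lt_of_dyadicIndex_eq (dyadicIndex_eq_of_cellDensity_ne_zero hx))
    (abs_sub_lt_of_dyadicIndex_eq (dyadicIndex_eq_of_cellDensity_ne_zero hy))).trans ?_
  simp [lintegral_cellDensity]

theorem realKernel_le_add_one {x y x' y' : ℝ} (hxy : x ≠ y) (h : |x - y| / 2 ≤ |x' - y'|) :
    realKernel x' y' ≤ realKernel x y + 1 := by
  have hd : 0 < |x - y| := abs_pos.2 (sub_ne_zero.2 hxy)
  have hxy' : x' ≠ y' := sub_ne_zero.1 (abs_pos.1 ((half_pos hd).trans_le h))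
  have hlog := Real.log_le_log (by positivity) h
  rw [Real.log_div hd.ne' (by norm_num)] at hlog
  rw [realKernel_of_ne hxy, realKernel_of_ne hxy', ← ENNReal.ofReal_one]
  refine (ENNReal.ofReal_le_ofReal ?_).trans ENNReal.ofReal_add_le
  linarith [Real.log_two_lt_d9]

/- Over cells that are far apart the kernel varies boundedly; otherwise `|s - t|` is `O(2⁻ᵐ)`, so
that the energy of the cells, which is at most `m log 2 + 2`, is small enough. -/
theorem mutualEnergy_cellDensity_le_realKernel_add (m : ℕ) (s t : ℝ) :
    mutualEnergy (cellDensity m s) (cellDensity m t) ≤ realKernel s t + 4 := by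
  rcases eq_or_ne s t with rfl | hst
  · simp [realKernel_self]
  rcases le_or_gt (4 * (1 / 2) ^ m) |s - t| with hfar | hclose
  · refine (mutualEnergy_cellDensity_le_of_forall fun x y hx hy =>
      realKernel_le_add_one hst ?_).trans
      (by gcongr; norm_num)
    have := abs_sub_le s x t
    have := abs_sub_le x y t
    have := abs_sub_comm y t
    linarith
  · have hlog := Real.log_le_log (abs_pos.2 (sub_ne_zero.2 hst)) hclose.le
    rw [Real.log_mul (by norm_num) (by positivity), Real.log_pow, one_div, Real.log_inv,
      show (4 : ℝ) = 2 ^ 2 by norm_num, Real.log_pow] at hlog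
    push_cast at hlog
    refine (mutualEnergy_cellDensity_le m s t).trans ?_
    calc ENNReal.ofReal (m * Real.log 2) + 2
        ≤ ENNReal.ofReal (-Real.log |s - t| + (2 : ℕ)) + 2 := by
          gcongr
          push_cast
          linarith [Real.log_two_lt_d9]
      _ ≤ realKernel s t + 2 + 2 := by
          rw [realKernel_of_ne hst]
          gcongr
          exact ENNReal.ofReal_add_le.trans (by simp)
      _ = realKernel s t + 4 := by rw [add_assoc]; norm_num

theorem limsup_mutualEnergy_cellDensity_le (s t : ℝ) :
    limsup (fun m => mutualEnergy (cellDensity m s) (cellDensity m t)) atTop ≤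
      realKernel s t := by
  refine le_of_forall_gt_imp_ge_of_dense fun C hC => ?_
  have hnear : ∀ᶠ p in 𝓝 s ×ˢ 𝓝 t, realKernel p.1 p.2 < C := by
    rw [← nhds_prod_eq]
    exact (Continuous.tendsto (by fun_prop) (s, t)).eventually_lt_const hC
  obtain ⟨p, hp, q, hq, hpq⟩ := eventually_prod_iff.1 hnear
  obtain ⟨ε, hε, hball⟩ := Metric.eventually_nhds_iff.1 hp
  obtain ⟨δ, hδ, hball'⟩ := Metric.eventually_nhds_iff.1 hq
  refine limsup_le_of_le (by isBoundedDefault) ?_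
  filter_upwards [(tendsto_pow_atTop_nhds_zero_of_lt_one one_half_pos.le
    one_half_lt_one).eventually_lt_const (lt_min hε hδ)] with m hm
  refine mutualEnergy_cellDensity_le_of_forall fun x y hx hy => (hpq (hball ?_) (hball' ?_)).le
  · rw [dist_comm, Real.dist_eq]; exact (hx.trans hm).trans_le (min_le_left _ _)
  · rw [dist_comm, Real.dist_eq]; exact (hy.trans hm).trans_le (min_le_right _ _)
/-! ### Step densities -/

/-- The densities on `[0, 1)` that are sums of functions `(b + 1)⁻¹ * cellDensity m s` with
`b : ℕ`: a countable family, rich enough to contain the random densities built from the intervals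
and to compute the capacity of `[0, 1]`. -/
noncomputable def stepDensity : AddSubmonoid (ℝ → ℝ≥0∞) :=
  AddSubmonoid.closure {u | ∃ b m : ℕ, ∃ s ∈ Ico (0 : ℝ) 1,
    u = fun x => (b + 1 : ℝ≥0∞)⁻¹ * cellDensity m s x}

theorem countable_addSubmonoid_closure {A : Type*} [AddMonoid A] {s : Set A} (hs : s.Countable) :
    (AddSubmonoid.closure s : Set A).Countable := by
  have := hs.to_subtype
  have : Countable (FreeAddMonoid s) := inferInstanceAs (Countable (List s))
  rw [AddSubmonoid.closure_eq_mrange]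
  exact countable_range _

theorem countable_stepDensity : (stepDensity : Set (ℝ → ℝ≥0∞)).Countable := by
  refine countable_addSubmonoid_closure ((countable_range fun q : ℕ × ℕ × ℤ => fun x =>
    (q.1 + 1 : ℝ≥0∞)⁻¹ * if q.2.2 = dyadicIndex q.2.1 x then 2 ^ q.2.1 else 0).mono ?_)
  rintro _ ⟨b, m, s, -, rfl⟩
  exact ⟨(b, m, dyadicIndex m s), rfl⟩

theorem natCast_mul_inv_mul_cellDensity_mem_stepDensity (a b m : ℕ) {s : ℝ}
    (hs : s ∈ Ico (0 : ℝ) 1) :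
    (fun x => (a : ℝ≥0∞) * ((b + 1 : ℝ≥0∞)⁻¹ * cellDensity m s x)) ∈ stepDensity := by
  have hmem : (fun x => (b + 1 : ℝ≥0∞)⁻¹ * cellDensity m s x) ∈ stepDensity :=
    AddSubmonoid.subset_closure ⟨b, m, s, hs, rfl⟩
  convert nsmul_mem hmem a using 1
  ext x
  simp

theorem natCast_mul_cellDensity_mem_stepDensity (a m : ℕ) {s : ℝ} (hs : s ∈ Ico (0 : ℝ) 1) :
    (fun x => (a : ℝ≥0∞) * cellDensity m s x) ∈ stepDensity := by
  simpa using natCast_mul_inv_mul_cellDensity_mem_stepDensity a 0 m hs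

theorem measurable_of_mem_stepDensity {h : ℝ → ℝ≥0∞} (hh : h ∈ stepDensity) : Measurable h := by
  induction hh using AddSubmonoid.closure_induction with
  | mem u hu =>
    obtain ⟨b, m, s, -, rfl⟩ := hu
    fun_prop
  | zero => exact measurable_const
  | add u v _ _ hu hv => exact hu.add hv

theorem exists_le_mul_cellDensity_of_mem_stepDensity {h : ℝ → ℝ≥0∞} (hh : h ∈ stepDensity) :
    ∃ B : ℝ≥0∞, B ≠ ⊤ ∧ ∀ x, h x ≤ B * cellDensity 0 0 x := by
  induction hh using AddSubmonoid.closure_induction with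
  | mem u hu =>
    obtain ⟨b, m, s, hs, rfl⟩ := hu
    exact ⟨(b + 1 : ℝ≥0∞)⁻¹ * 2 ^ m, by finiteness, fun x =>
      (mul_le_mul_right (cellDensity_le_mul_cellDensity_zero hs m x) _).trans_eq
        (mul_assoc _ _ _).symm⟩
  | zero => exact ⟨0, by simp, by simp⟩
  | add u v _ _ hu hv =>
    obtain ⟨A, hA, hu⟩ := hu
    obtain ⟨B, hB, hv⟩ := hv
    exact ⟨A + B, by finiteness, fun x => add_mul A B _ ▸ add_le_add (hu x) (hv x)⟩

theorem mem_Ico_of_mem_stepDensity {h : ℝ → ℝ≥0∞} (hh : h ∈ stepDensity) {x : ℝ}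
    (hx : h x ≠ 0) : x ∈ Ico (0 : ℝ) 1 := by
  obtain ⟨B, -, hB⟩ := exists_le_mul_cellDensity_of_mem_stepDensity hh
  by_contra hmem
  exact hx (by simpa [cellDensity_zero_zero, hmem] using hB x)

theorem lintegral_ne_top_of_mem_stepDensity {h : ℝ → ℝ≥0∞} (hh : h ∈ stepDensity) :
    ∫⁻ x, h x ≠ ⊤ := by
  obtain ⟨B, hB, hle⟩ := exists_le_mul_cellDensity_of_mem_stepDensity hh
  refine ne_top_of_le_ne_top hB ((lintegral_mono hle).trans_eq ?_)
  rw [lintegral_const_mul _ (by fun_prop), lintegral_cellDensity, mul_one]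

theorem exists_forall_eq_of_mem_stepDensity {h : ℝ → ℝ≥0∞} (hh : h ∈ stepDensity) :
    ∃ r, ∀ m ≥ r, ∀ x y, dyadicIndex m x = dyadicIndex m y → h x = h y := by
  induction hh using AddSubmonoid.closure_induction with
  | mem u hu =>
    obtain ⟨b, r, s, -, rfl⟩ := hu
    refine ⟨r, fun m hm x y hxy => ?_⟩
    simp only [cellDensity, dyadicIndex_eq_of_le hm hxy]
  | zero => exact ⟨0, by simp⟩
  | add u v _ _ hu hv =>
    obtain ⟨r, hr⟩ := hu
    obtain ⟨s, hs⟩ := hv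
    refine ⟨max r s, fun m hm x y hxy => ?_⟩
    rw [Pi.add_apply, Pi.add_apply, hr m (le_of_max_le_left hm) x y hxy,
      hs m (le_of_max_le_right hm) x y hxy]

/-! ### Approximation of a measure by step densities -/

/-- The density obtained by spreading the mass that `μ` gives to each dyadic cell of generation
`r` uniformly over the cell. -/
noncomputable def cellSmoothing (r : ℕ) (μ : Measure ℝ) (x : ℝ) : ℝ≥0∞ :=
  ∫⁻ s, cellDensity r s x ∂μ

theorem measurable_uncurry_cellDensity (r : ℕ) : Measurable (Function.uncurry (cellDensity r)) := by
  unfold Function.uncurry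
  fun_prop

theorem measurable_mutualEnergy_cellDensity (r : ℕ) :
    Measurable fun p : ℝ × ℝ => mutualEnergy (cellDensity r p.1) (cellDensity r p.2) := by
  have h : Measurable (Function.uncurry fun (p : ℝ × ℝ) x => cellDensity r p.1 x) := by
    unfold Function.uncurry
    fun_prop
  have h' : Measurable (Function.uncurry fun (p : ℝ × ℝ) x => cellDensity r p.2 x) := by
    unfold Function.uncurry
    fun_prop
  exact measurable_mutualEnergy h h'

theorem mutualEnergy_cellSmoothing (r : ℕ) (μ : Measure ℝ) [SFinite μ] :
    mutualEnergy (cellSmoothing r μ) (cellSmoothing r μ) =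
      ∫⁻ p : ℝ × ℝ, mutualEnergy (cellDensity r p.1) (cellDensity r p.2) ∂(μ.prod μ) := by
  rw [lintegral_prod _ (measurable_mutualEnergy_cellDensity r).aemeasurable]
  exact (lintegral_lintegral_mutualEnergy (measurable_uncurry_cellDensity r)
    (measurable_uncurry_cellDensity r)).symm

theorem exists_mutualEnergy_cellSmoothing_lt {μ : Measure ℝ} [IsFiniteMeasure μ] {t : ℝ≥0∞}
    (h : realEnergy μ < t) : ∃ r, mutualEnergy (cellSmoothing r μ) (cellSmoothing r μ) < t := by
  rw [realEnergy_eq_lintegral_prod] at h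
  have hfin : ∫⁻ p : ℝ × ℝ, (realKernel p.1 p.2 + 4) ∂(μ.prod μ) ≠ ⊤ := by
    rw [lintegral_add_left (by fun_prop), lintegral_const]
    have := h.ne_top
    finiteness
  have hlimsup :
      limsup (fun r => mutualEnergy (cellSmoothing r μ) (cellSmoothing r μ)) atTop < t := by
    simp only [mutualEnergy_cellSmoothing]
    exact ((limsup_lintegral_le _ measurable_mutualEnergy_cellDensity (fun r =>
      Eventually.of_forall fun p => mutualEnergy_cellDensity_le_realKernel_add r p.1 p.2)
      hfin).trans (lintegral_mono fun p => limsup_mutualEnergy_cellDensity_le p.1 p.2)).trans_lt h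
  exact (eventually_lt_of_limsup_lt hlimsup).exists

theorem exists_dyadicIndex_eq_natCast {x : ℝ} (hx : x ∈ Ico (0 : ℝ) 1) (r : ℕ) :
    ∃ i ∈ Finset.range (2 ^ r), dyadicIndex r x = (i : ℕ) := by
  have h2 : (0 : ℝ) < 2 ^ r := by positivity
  obtain ⟨i, hi⟩ := Int.eq_ofNat_of_zero_le (Int.floor_nonneg.2 (mul_nonneg h2.le hx.1))
  have hlt : ⌊(2 : ℝ) ^ r * x⌋ < ((2 ^ r : ℕ) : ℤ) := by
    rw [Int.floor_lt]
    push_cast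
    nlinarith [hx.2]
  rw [hi, Nat.cast_lt] at hlt
  exact ⟨i, Finset.mem_range.2 hlt, hi⟩

theorem dyadicIndex_natCast_div (r i : ℕ) : dyadicIndex r (i / 2 ^ r) = i := by
  rw [dyadicIndex, mul_div_cancel₀ _ (by positivity), Int.floor_natCast]

theorem lintegral_sum_mul_cellDensity {ι : Type*} (s : Finset ι) (a : ι → ℝ≥0∞) (m : ℕ)
    (c : ι → ℝ) : ∫⁻ x, ∑ i ∈ s, a i * cellDensity m (c i) x = ∑ i ∈ s, a i := by
  rw [lintegral_finsetSum _ fun i _ => by fun_prop]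
  refine Finset.sum_congr rfl fun i _ => ?_
  rw [lintegral_const_mul _ (by fun_prop), lintegral_cellDensity, mul_one]

theorem cellSmoothing_eq_sum {μ : Measure ℝ} (hμ : ∀ᵐ x ∂μ, x ∈ Ico (0 : ℝ) 1) (r : ℕ) (x : ℝ) :
    cellSmoothing r μ x = ∑ i ∈ Finset.range (2 ^ r),
      μ {s | dyadicIndex r s = i} * cellDensity r (i / 2 ^ r) x := by
  have hcell : ∀ᵐ s ∂μ, cellDensity r s x = ∑ i ∈ Finset.range (2 ^ r),
      {s | dyadicIndex r s = i}.indicator (fun _ => cellDensity r (i / 2 ^ r) x) s := by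
    filter_upwards [hμ] with s hs
    obtain ⟨i, hi, his⟩ := exists_dyadicIndex_eq_natCast hs r
    rw [Finset.sum_eq_single_of_mem i hi fun j _ hj =>
      indicator_of_notMem (by simpa [his] using hj.symm) _,
      indicator_of_mem (show s ∈ {s | dyadicIndex r s = i} from his)]
    simp only [cellDensity, his, dyadicIndex_natCast_div]
  rw [cellSmoothing, lintegral_congr_ae hcell, lintegral_finsetSum _ fun i _ => by measurability]
  refine Finset.sum_congr rfl fun i _ => ?_
  rw [lintegral_indicator_const (measurableSet_eq_fun (by fun_prop) (by fun_prop)), mul_comm]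

theorem natCast_floor_toReal_le (x : ℝ≥0∞) : (⌊x.toReal⌋₊ : ℝ≥0∞) ≤ x := by
  rw [← ENNReal.ofReal_natCast]
  exact (ENNReal.ofReal_le_ofReal (Nat.floor_le ENNReal.toReal_nonneg)).trans
    ENNReal.ofReal_toReal_le

theorem le_natCast_floor_toReal_add_one {x : ℝ≥0∞} (hx : x ≠ ⊤) : x ≤ ⌊x.toReal⌋₊ + 1 := by
  rw [← ENNReal.toReal_le_toReal hx (by finiteness), ENNReal.toReal_add (by finiteness) (by simp)]
  simpa using (Nat.lt_floor_add_one x.toReal).le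

theorem lintegral_cellSmoothing (r : ℕ) (μ : Measure ℝ) [SFinite μ] :
    ∫⁻ x, cellSmoothing r μ x = μ univ := by
  unfold cellSmoothing
  rw [lintegral_lintegral_swap (by fun_prop)]
  simp [lintegral_cellDensity]

theorem exists_natCast_mutualEnergy_lt {ι : Type*} {s : Finset ι} {a : ι → ℝ≥0∞}
    (ha : ∑ i ∈ s, a i = 1) {e : ι → ℝ → ℝ≥0∞} {t : ℝ≥0∞}
    (h : mutualEnergy (fun x => ∑ i ∈ s, a i * e i x) (fun x => ∑ i ∈ s, a i * e i x) < t) :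
    ∃ n : ι → ℕ, mutualEnergy (fun x => ∑ i ∈ s, (n i : ℝ≥0∞) * e i x)
      (fun x => ∑ i ∈ s, (n i : ℝ≥0∞) * e i x) < t * (∑ i ∈ s, (n i : ℝ≥0∞)) ^ 2 := by
  set E := mutualEnergy (fun x => ∑ i ∈ s, a i * e i x) (fun x => ∑ i ∈ s, a i * e i x)
  have htop : ∀ i ∈ s, a i ≠ ⊤ := fun i hi =>
    ne_top_of_le_ne_top ENNReal.one_ne_top (ha ▸ Finset.single_le_sum_of_canonicallyOrdered hi)
  have hlim : Tendsto (fun N : ℕ => (1 + s.card * (N : ℝ≥0∞)⁻¹) ^ 2 * E) atTop (𝓝 E) := by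
    have hinv := ENNReal.Tendsto.const_mul ENNReal.tendsto_inv_nat_nhds_zero
      (Or.inr (ENNReal.natCast_ne_top s.card))
    simpa using ENNReal.Tendsto.mul_const (ENNReal.Tendsto.pow (n := 2) (hinv.const_add 1))
      (Or.inr h.ne_top)
  obtain ⟨N, hN, hN0⟩ := ((hlim.eventually_lt_const h).and (eventually_gt_atTop 0)).exists
  have hN0' : (N : ℝ≥0∞) ≠ 0 := by exact_mod_cast hN0.ne'
  set n : ι → ℕ := fun i => ⌊((N + s.card : ℕ) * a i).toReal⌋₊
  have hn_le : ∀ i, (n i : ℝ≥0∞) ≤ (N + s.card : ℕ) * a i := fun i =>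
    natCast_floor_toReal_le _
  have hn_ge : (N : ℝ≥0∞) ≤ ∑ i ∈ s, (n i : ℝ≥0∞) := by
    refine (ENNReal.add_le_add_iff_right (ENNReal.natCast_ne_top s.card)).1 ?_
    calc (N : ℝ≥0∞) + s.card = ∑ i ∈ s, (N + s.card : ℕ) * a i := by
          rw [← Finset.mul_sum, ha, mul_one, Nat.cast_add]
      _ ≤ ∑ i ∈ s, ((n i : ℝ≥0∞) + 1) := Finset.sum_le_sum fun i hi =>
          le_natCast_floor_toReal_add_one (ENNReal.mul_ne_top (by finiteness) (htop i hi))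
      _ = ∑ i ∈ s, (n i : ℝ≥0∞) + s.card := by simp [Finset.sum_add_distrib]
  refine ⟨n, ?_⟩
  calc mutualEnergy (fun x => ∑ i ∈ s, (n i : ℝ≥0∞) * e i x) (fun x => ∑ i ∈ s, n i * e i x)
      ≤ ((N + s.card : ℕ) : ℝ≥0∞) * (N + s.card : ℕ) * E := by
        rw [← mutualEnergy_const_mul (by finiteness) (by finiteness)]
        simp only [Finset.mul_sum, ← mul_assoc]
        exact mutualEnergy_mono (fun x => by gcongr; exact hn_le _)
          fun x => by gcongr; exact hn_le _
    _ = (1 + s.card * (N : ℝ≥0∞)⁻¹) ^ 2 * E * (N : ℝ≥0∞) ^ 2 := by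
        have hcancel : ((N + s.card : ℕ) : ℝ≥0∞) = (1 + s.card * (N : ℝ≥0∞)⁻¹) * N := by
          rw [add_mul, mul_assoc, ENNReal.inv_mul_cancel hN0' (by finiteness)]
          push_cast
          ring
        rw [hcancel]
        ring
    _ < t * (N : ℝ≥0∞) ^ 2 := ENNReal.mul_lt_mul_left (by simpa using hN0.ne') (by finiteness) hN
    _ ≤ t * (∑ i ∈ s, (n i : ℝ≥0∞)) ^ 2 := by gcongr

theorem exists_stepDensity_of_realEnergy_lt {μ : Measure ℝ} [IsProbabilityMeasure μ]
    (hμ : ∀ᵐ x ∂μ, x ∈ Icc (0 : ℝ) 1) {t : ℝ≥0∞} (h : realEnergy μ < t) :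
    ∃ u ∈ stepDensity, mutualEnergy u u < t * (∫⁻ x, u x) ^ 2 := by
  obtain ⟨r, hr⟩ := exists_mutualEnergy_cellSmoothing_lt h
  have hIco : ∀ᵐ x ∂μ, x ∈ Ico (0 : ℝ) 1 := by
    filter_upwards [hμ, compl_mem_ae_iff.2
      (measure_singleton_eq_zero_of_realEnergy_ne_top h.ne_top 1)] with x hx hx1
    exact ⟨hx.1, lt_of_le_of_ne hx.2 hx1⟩
  have hv : cellSmoothing r μ = fun x => ∑ i ∈ Finset.range (2 ^ r),
      μ {s | dyadicIndex r s = i} * cellDensity r (i / 2 ^ r) x :=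
    funext (cellSmoothing_eq_sum hIco r)
  have hmass : ∑ i ∈ Finset.range (2 ^ r), μ {s | dyadicIndex r s = i} = 1 := by
    rw [← lintegral_sum_mul_cellDensity (Finset.range (2 ^ r)) _ r fun i => i / 2 ^ r, ← hv,
      lintegral_cellSmoothing, measure_univ]
  rw [hv] at hr
  obtain ⟨n, hn⟩ := exists_natCast_mutualEnergy_lt hmass hr
  rw [← lintegral_sum_mul_cellDensity (Finset.range (2 ^ r)) _ r fun i => i / 2 ^ r] at hn
  refine ⟨_, ?_, hn⟩
  rw [← Finset.sum_fn]
  refine sum_mem fun i hi => natCast_mul_cellDensity_mem_stepDensity (n i) r ⟨by positivity, ?_⟩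
  rw [div_lt_one (by positivity)]
  exact_mod_cast Finset.mem_range.1 hi

/-! ### Capacity of subsets of `[0, 1]` -/

theorem map_ofReal_map_re {μ : Measure ℂ} {s : Set ℝ} (hμ : ∀ᵐ z ∂μ, z ∈ ((↑) : ℝ → ℂ) '' s) :
    (μ.map Complex.re).map ((↑) : ℝ → ℂ) = μ := by
  rw [Measure.map_map Complex.measurable_ofReal Complex.measurable_re]
  conv_rhs => rw [← Measure.map_id (μ := μ)]
  refine Measure.map_congr ?_
  filter_upwards [hμ] with z ⟨x, _, hx⟩
  simp [← hx]

theorem exp_neg_realEnergy_le_logCapacity {μ : Measure ℝ} [IsProbabilityMeasure μ] {E K : Set ℝ}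
    (hK : IsCompact K) (hK_Icc : K ⊆ Icc 0 1) (hKE : K ⊆ E) (hμ : ∀ᵐ x ∂μ, x ∈ K) :
    EReal.exp (-(realEnergy μ : EReal)) ≤ logCapacity (((↑) : ℝ → ℂ) '' E) := by
  have hm : Measurable ((↑) : ℝ → ℂ) := Complex.measurable_ofReal
  have hKc : IsCompact (((↑) : ℝ → ℂ) '' K) := hK.image Complex.continuous_ofReal
  have hsupp : (μ.map ((↑) : ℝ → ℂ)).support ⊆ ((↑) : ℝ → ℂ) '' K :=
    Measure.support_subset_of_isClosed hKc.isClosed <|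
      (ae_map_iff hm.aemeasurable hKc.measurableSet).2 <|
        hμ.mono fun x hx => mem_image_of_mem _ hx
  rw [← logEnergy_map_ofReal (hμ.mono fun x hx => hK_Icc hx), logCapacity, EReal.exp_le_exp_iff,
    EReal.neg_le_neg_iff]
  exact sInf_le ⟨μ.map (↑), Measure.isProbabilityMeasure_map hm.aemeasurable,
    hKc.of_isClosed_subset Measure.isClosed_support hsupp, hsupp.trans (image_mono hKE), rfl⟩

theorem logCapacity_Icc_le {b : ℝ≥0∞}
    (h : ∀ μ : Measure ℝ, IsProbabilityMeasure μ → (∀ᵐ x ∂μ, x ∈ Icc (0 : ℝ) 1) →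
      ∀ q : ℚ, realEnergy μ < ENNReal.ofReal q →
        EReal.exp (-((ENNReal.ofReal q : ℝ≥0∞) : EReal)) ≤ b) :
    logCapacity (((↑) : ℝ → ℂ) '' Icc (0 : ℝ) 1) ≤ b := by
  rw [← ENNReal.exp_log b] at h ⊢
  simp only [EReal.exp_le_exp_iff, EReal.neg_le, logCapacity] at h ⊢
  refine le_sInf ?_
  rintro _ ⟨μ, hμ, -, hμ_supp, rfl⟩
  have hmem : ∀ᵐ z ∂μ, z ∈ ((↑) : ℝ → ℂ) '' Icc (0 : ℝ) 1 :=
    Filter.mem_of_superset Measure.support_mem_ae hμ_supp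
  have hmem_re : ∀ᵐ x ∂(μ.map Complex.re), x ∈ Icc (0 : ℝ) 1 := by
    refine (ae_map_iff Complex.measurable_re.aemeasurable measurableSet_Icc).2 ?_
    filter_upwards [hmem] with z ⟨x, hx, hxz⟩
    simpa [← hxz] using hx
  have hprob := Measure.isProbabilityMeasure_map (μ := μ) Complex.measurable_re.aemeasurable
  rw [← map_ofReal_map_re hmem, logEnergy_map_ofReal hmem_re]
  refine le_of_forall_gt fun e he => ?_
  obtain ⟨q, hlt, hqe⟩ := EReal.lt_iff_exists_rat_btwn.1 he
  have hq : ((ENNReal.ofReal q : ℝ≥0∞) : EReal) = ((q : ℝ) : EReal) := by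
    rw [EReal.coe_ennreal_ofReal, max_eq_left]
    exact_mod_cast (EReal.coe_ennreal_nonneg _).trans hlt.le
  rw [← hq] at hlt hqe
  exact (h _ hprob hmem_re q (EReal.coe_ennreal_lt_coe_ennreal_iff.1 hlt)).trans_lt hqe

theorem realEnergy_withDensity {u : ℝ → ℝ≥0∞} (hu : Measurable u) :
    realEnergy (volume.withDensity u) = mutualEnergy u u := by
  rw [realEnergy_eq_lintegral_prod, prod_withDensity hu hu, mutualEnergy_eq_lintegral_prod hu hu,
    lintegral_withDensity_eq_lintegral_mul _ (by fun_prop) (by fun_prop)]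
  exact lintegral_congr fun q => mul_comm _ _

theorem exists_isProbabilityMeasure_realEnergy_le {u : ℝ → ℝ≥0∞} (hu : Measurable u)
    (hu_top : ∫⁻ x, u x ≠ ⊤) {t : ℝ≥0∞} (h : mutualEnergy u u < t * (∫⁻ x, u x) ^ 2) :
    ∃ μ : Measure ℝ, IsProbabilityMeasure μ ∧ μ ≪ volume.withDensity u ∧ realEnergy μ ≤ t := by
  have hu_zero : ∫⁻ x, u x ≠ 0 := fun h0 => by simp [h0] at h
  set a := (∫⁻ x, u x)⁻¹ with ha
  have ha_top : a ≠ ⊤ := ENNReal.inv_ne_top.2 hu_zero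
  refine ⟨volume.withDensity (a • u), ⟨?_⟩, ?_, ?_⟩
  · simp only [withDensity_apply _ MeasurableSet.univ, Measure.restrict_univ, Pi.smul_apply,
      smul_eq_mul]
    rw [lintegral_const_mul _ hu, ha, ENNReal.inv_mul_cancel hu_zero hu_top]
  · rw [withDensity_smul _ hu]
    exact Measure.smul_absolutelyContinuous
  · rw [realEnergy_withDensity (hu.const_smul a)]
    refine (mutualEnergy_const_mul ha_top ha_top u u).trans_le ?_
    rw [← sq, ha, ← ENNReal.inv_pow, mul_comm, ← div_eq_mul_inv]
    exact ENNReal.div_le_of_le_mul h.le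

theorem logCapacity_Icc_pos : 0 < logCapacity (((↑) : ℝ → ℂ) '' Icc (0 : ℝ) 1) := by
  have hu : Measurable (cellDensity 0 0) := by fun_prop
  have hlt : mutualEnergy (cellDensity 0 0) (cellDensity 0 0) <
      3 * (∫⁻ x, cellDensity 0 0 x) ^ 2 := by
    rw [lintegral_cellDensity, one_pow, mul_one]
    refine (mutualEnergy_cellDensity_le_two_mul 0 0 0).trans_lt ?_
    norm_num
  obtain ⟨μ, hμ, hμ_ac, hμ_le⟩ := exists_isProbabilityMeasure_realEnergy_le hu
    (by simp [lintegral_cellDensity]) hlt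
  have hmem : ∀ᵐ x ∂μ, x ∈ Icc (0 : ℝ) 1 := by
    refine hμ_ac.ae_le ((ae_withDensity_iff hu).2 (ae_of_all _ fun x hx => ?_))
    rw [cellDensity_zero_zero] at hx
    exact Ico_subset_Icc_self (mem_of_indicator_ne_zero hx)
  refine lt_of_lt_of_le ?_
    (exp_neg_realEnergy_le_logCapacity isCompact_Icc subset_rfl subset_rfl hmem)
  rw [EReal.zero_lt_exp_iff, bot_lt_iff_ne_bot, Ne, EReal.neg_eq_bot_iff,
    EReal.coe_ennreal_eq_top_iff]
  exact ne_top_of_le_ne_top (by finiteness) hμ_le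

/-! ### Weak limits -/

theorem exists_tendsto_of_ae_mem_isCompact {X ι : Type*} [TopologicalSpace X] [T2Space X]
    [MeasurableSpace X] [BorelSpace X] {μ : ι → ProbabilityMeasure X} {K : Set X}
    (hK : IsCompact K) (hμ : ∀ i, ∀ᵐ x ∂(μ i : Measure X), x ∈ K) (F : Ultrafilter ι) :
    ∃ ν, Tendsto μ F (𝓝 ν) := by
  have htight : IsTightMeasureSet {((m : ProbabilityMeasure X) : Measure X) | m ∈ range μ} := by
    refine isTightMeasureSet_iff_exists_isCompact_measure_compl_le.2 fun ε _ => ⟨K, hK, ?_⟩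
    rintro _ ⟨_, ⟨i, rfl⟩, rfl⟩
    exact (ae_iff.1 (hμ i)).trans_le zero_le
  obtain ⟨ν, -, hν⟩ := (isCompact_closure_of_isTightMeasureSet htight).ultrafilter_le_nhds
    (F.map μ) (le_principal_iff.2 <| mem_map.2 <| univ_mem' fun i =>
      subset_closure (mem_range_self i))
  exact ⟨ν, hν⟩

theorem ae_mem_of_tendsto {X ι : Type*} [TopologicalSpace X] [MeasurableSpace X]
    [OpensMeasurableSpace X] [HasOuterApproxClosed X] {F : Filter ι} [NeBot F]
    {μ : ι → ProbabilityMeasure X} {ν : ProbabilityMeasure X} (hμ : Tendsto μ F (𝓝 ν))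
    {K : Set X} (hK : IsClosed K) (h : ∀ᶠ i in F, ∀ᵐ x ∂(μ i : Measure X), x ∈ K) :
    ∀ᵐ x ∂(ν : Measure X), x ∈ K := by
  have hzero : ∀ᶠ i in F, (μ i : Measure X) Kᶜ = 0 := h
  have hle := ProbabilityMeasure.le_liminf_measure_open_of_tendsto hμ hK.isOpen_compl
  rwa [liminf_congr hzero, liminf_const, nonpos_iff_eq_zero] at hle

theorem lintegral_le_of_tendsto {X ι : Type*} [TopologicalSpace X] [MeasurableSpace X]
    [OpensMeasurableSpace X] {F : Filter ι} [NeBot F] {μ : ι → ProbabilityMeasure X}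
    {ν : ProbabilityMeasure X} (hμ : Tendsto μ F (𝓝 ν)) {f : X → ℝ≥0∞} (hf : Continuous f)
    {t : ℝ≥0∞} (h : ∀ᶠ i in F, ∫⁻ x, f x ∂(μ i : Measure X) ≤ t) :
    ∫⁻ x, f x ∂(ν : Measure X) ≤ t := by
  have hf_iSup : ∀ x, f x = ⨆ n : ℕ, min (f x) n := fun x => by
    rw [← inf_iSup_eq, ENNReal.iSup_natCast, inf_top_eq]
  rw [lintegral_congr hf_iSup, lintegral_iSup (fun n => hf.measurable.min measurable_const)
    fun a b hab x => min_le_min_left _ (Nat.cast_le.2 hab)]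
  refine iSup_le fun n => ?_
  have hne_top : ∀ x, min (f x) n ≠ ⊤ := fun x =>
    ne_top_of_le_ne_top (ENNReal.natCast_ne_top n) (min_le_right _ _)
  have hcont : Continuous fun x => (min (f x) n).toNNReal :=
    ENNReal.continuousOn_toNNReal.comp_continuous (hf.min continuous_const) hne_top
  have hle : ∀ x, (min (f x) n).toNNReal ≤ n := fun x => by
    simpa using ENNReal.toNNReal_mono (ENNReal.natCast_ne_top n) (min_le_right (f x) n)
  let g : BoundedContinuousFunction X NNReal :=
    BoundedContinuousFunction.mkOfBound ⟨_, hcont⟩ n fun x y =>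
      abs_sub_le_of_nonneg_of_le (NNReal.coe_nonneg _) (by exact_mod_cast hle x)
        (NNReal.coe_nonneg _) (by exact_mod_cast hle y)
  have hg : ∀ x, (g x : ℝ≥0∞) = min (f x) n := fun x => ENNReal.coe_toNNReal (hne_top x)
  have hlim := ProbabilityMeasure.tendsto_iff_forall_lintegral_tendsto.1 hμ g
  simp_rw [hg] at hlim
  exact le_of_tendsto hlim (h.mono fun i hi => (lintegral_mono fun x => min_le_left _ _).trans hi)

theorem exists_measure_of_antitone {μ : ℕ → Measure ℝ} (hμ : ∀ j, IsProbabilityMeasure (μ j))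
    {K : ℕ → Set ℝ} (hK : ∀ j, IsCompact (K j)) (hK_anti : Antitone K)
    (hμK : ∀ j, ∀ᵐ x ∂(μ j), x ∈ K j) {t : ℝ≥0∞} (ht : ∀ j, realEnergy (μ j) ≤ t) :
    ∃ ν : Measure ℝ, IsProbabilityMeasure ν ∧ (∀ᵐ x ∂ν, x ∈ ⋂ j, K j) ∧ realEnergy ν ≤ t := by
  let m : ℕ → ProbabilityMeasure ℝ := fun j => ⟨μ j, hμ j⟩
  have hmem : ∀ j, ∀ i ≥ j, ∀ᵐ x ∂(m i : Measure ℝ), x ∈ K j := fun j i hi =>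
    (hμK i).mono fun x hx => hK_anti hi hx
  obtain ⟨ν, hν⟩ := exists_tendsto_of_ae_mem_isCompact (hK 0) (fun i => hmem 0 i i.zero_le)
    (hyperfilter ℕ)
  refine ⟨ν, inferInstance, ?_, ?_⟩
  · simp only [mem_iInter]
    refine ae_all_iff.2 fun j => ae_mem_of_tendsto hν (hK j).isClosed ?_
    exact Eventually.mono (Nat.hyperfilter_le_atTop (eventually_ge_atTop j)) (hmem j)
  · have hprod : Tendsto (fun j => (m j).prod (m j)) (hyperfilter ℕ : Filter ℕ)
        (𝓝 (ν.prod ν)) :=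
      (ProbabilityMeasure.continuous_prod.tendsto (ν, ν)).comp (hν.prodMk_nhds hν)
    rw [realEnergy_eq_lintegral_prod]
    refine lintegral_le_of_tendsto hprod (continuous_realKernel continuous_fst continuous_snd)
      (Eventually.of_forall fun j => ?_)
    exact (realEnergy_eq_lintegral_prod (m j : Measure ℝ)).symm.trans_le (ht j)

/-! ### Nested step densities -/

theorem exp_neg_le_logCapacity_of_antitone_support {E : Set ℝ} {t : ℝ≥0∞} {u : ℕ → ℝ → ℝ≥0∞}
    (hu : ∀ j, u j ∈ stepDensity)
    (hu_lt : ∀ j, mutualEnergy (u j) (u j) < t * (∫⁻ x, u j x) ^ 2)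
    (hu_supp : ∀ j, Function.support (u (j + 1)) ⊆ Function.support (u j))
    (hE : ⋂ j, tsupport (u j) ⊆ E) :
    EReal.exp (-(t : EReal)) ≤ logCapacity (((↑) : ℝ → ℂ) '' E) := by
  choose μ hμ hμ_ac hμ_le using fun j => exists_isProbabilityMeasure_realEnergy_le
    (measurable_of_mem_stepDensity (hu j)) (lintegral_ne_top_of_mem_stepDensity (hu j)) (hu_lt j)
  have hIcc : ∀ j, tsupport (u j) ⊆ Icc 0 1 := fun j => closure_minimal
    (fun x hx => Ico_subset_Icc_self (mem_Ico_of_mem_stepDensity (hu j) hx)) isClosed_Icc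
  have hcompact : ∀ j, IsCompact (tsupport (u j)) := fun j =>
    isCompact_Icc.of_isClosed_subset (isClosed_tsupport _) (hIcc j)
  have hmem : ∀ j, ∀ᵐ x ∂(μ j), x ∈ tsupport (u j) := fun j =>
    (hμ_ac j).ae_le <| (ae_withDensity_iff (measurable_of_mem_stepDensity (hu j))).2 <|
      ae_of_all _ fun x hx => subset_tsupport _ hx
  obtain ⟨ν, hν, hν_mem, hν_le⟩ := exists_measure_of_antitone hμ hcompact
    (antitone_nat_of_succ_le fun j => closure_mono (hu_supp j)) hmem hμ_le
  have hle : EReal.exp (-(t : EReal)) ≤ EReal.exp (-(realEnergy ν : EReal)) := by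
    rw [EReal.exp_le_exp_iff, EReal.neg_le_neg_iff]
    exact_mod_cast hν_le
  exact hle.trans (exp_neg_realEnergy_le_logCapacity
    ((hcompact 0).of_isClosed_subset (isClosed_iInter fun j => isClosed_tsupport _)
      (iInter_subset _ 0)) ((iInter_subset _ 0).trans (hIcc 0)) hE hν_mem)

theorem logCapacity_Icc_le_limsupIntervals {c l : ℕ → ℝ}
    (hstep : ∀ q : ℚ, ∀ h ∈ stepDensity,
      mutualEnergy h h < ENNReal.ofReal q * (∫⁻ x, h x) ^ 2 →
      ∀ n, ∃ u ∈ stepDensity, mutualEnergy u u < ENNReal.ofReal q * (∫⁻ x, u x) ^ 2 ∧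
        Function.support u ⊆ Function.support h ∧
        tsupport u ⊆ ⋃ k ≥ n, Ioo (c k - l k / 2) (c k + l k / 2)) :
    logCapacity (((↑) : ℝ → ℂ) '' Icc (0 : ℝ) 1) ≤
      logCapacity (((↑) : ℝ → ℂ) '' limsupIntervals c l) := by
  refine logCapacity_Icc_le fun μ hμ hμ_mem q hq => ?_
  obtain ⟨u₀, hu₀, hu₀_lt⟩ := exists_stepDensity_of_realEnergy_lt hμ_mem hq
  let T := {u : ℝ → ℝ≥0∞ // u ∈ stepDensity ∧
    mutualEnergy u u < ENNReal.ofReal q * (∫⁻ x, u x) ^ 2}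
  have hnext : ∀ (n : ℕ) (h : T), ∃ u : T, Function.support u.1 ⊆ Function.support h.1 ∧
      tsupport u.1 ⊆ ⋃ k ≥ n, Ioo (c k - l k / 2) (c k + l k / 2) := by
    intro n h
    obtain ⟨u, hu, hu_lt, hu_supp⟩ := hstep q h.1 h.2.1 h.2.2 n
    exact ⟨⟨u, hu, hu_lt⟩, hu_supp⟩
  choose next hnext_supp hnext_tsupp using hnext
  let u : ℕ → T := Nat.rec ⟨u₀, hu₀, hu₀_lt⟩ next
  refine exp_neg_le_logCapacity_of_antitone_support (u := fun j => (u j).1)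
    (fun j => (u j).2.1) (fun j => (u j).2.2) (fun j => hnext_supp j (u j)) ?_
  exact subset_iInter fun n => (iInter_subset _ (n + 1)).trans (hnext_tsupp n (u n))

theorem limsupIntervals_subset {c l : ℕ → ℝ} {K : Set ℝ} (hK : IsClosed K) (hc : ∀ k, c k ∈ K)
    (hl : Tendsto l atTop (𝓝 0)) : limsupIntervals c l ⊆ K := by
  intro x hx
  refine hK.closure_subset (Metric.mem_closure_iff.2 fun ε hε => ?_)
  obtain ⟨k, hk, hlk⟩ := ((frequently_mem_Ioo_of_mem_limsupIntervals hx).and_eventually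
    (hl.eventually_lt_const hε)).exists
  refine ⟨c k, hc k, ?_⟩
  rw [Real.dist_eq, abs_lt]
  constructor <;> linarith [hk.1, hk.2]

/-! ### Random superpositions of cells -/

/-- The cell of generation `m` containing `z`, with mass `g z / (m + 1)`. Since the energy of the
cell is of order `m + 1`, this normalization makes the energy of the diagonal terms in a
superposition proportional to the mass. -/
noncomputable def weightedCell (m : ℕ) (g : ℝ → ℕ) (z x : ℝ) : ℝ≥0∞ :=
  (m + 1 : ℝ≥0∞)⁻¹ * (g z * cellDensity m z x)

theorem measurable_uncurry_weightedCell (m : ℕ) {g : ℝ → ℕ} (hg : Measurable g) :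
    Measurable (Function.uncurry (weightedCell m g)) := by
  have hcast : Measurable (Nat.cast : ℕ → ℝ≥0∞) := measurable_of_countable _
  unfold weightedCell Function.uncurry
  fun_prop

theorem lintegral_weightedCell (m : ℕ) (g : ℝ → ℕ) (z : ℝ) :
    ∫⁻ x, weightedCell m g z x = (m + 1 : ℝ≥0∞)⁻¹ * g z := by
  unfold weightedCell
  rw [lintegral_const_mul _ (by fun_prop), lintegral_const_mul _ (by fun_prop),
    lintegral_cellDensity, mul_one]

theorem mutualEnergy_weightedCell_le (m : ℕ) {g : ℝ → ℕ} {G : ℕ} (hG : ∀ x, g x ≤ G) (z : ℝ) :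
    mutualEnergy (weightedCell m g z) (weightedCell m g z) ≤ (m + 1 : ℝ≥0∞)⁻¹ * (2 * G ^ 2) := by
  have hinv : (m + 1 : ℝ≥0∞)⁻¹ * (m + 1) = 1 :=
    ENNReal.inv_mul_cancel (by simp) (by finiteness)
  have hle : weightedCell m g z ≤ fun x => ((m + 1 : ℝ≥0∞)⁻¹ * G) * cellDensity m z x := by
    intro x
    simp only [weightedCell, mul_assoc]
    gcongr
    exact hG z
  calc mutualEnergy (weightedCell m g z) (weightedCell m g z)
      ≤ ((m + 1 : ℝ≥0∞)⁻¹ * G) * ((m + 1 : ℝ≥0∞)⁻¹ * G) * (2 * (m + 1)) := by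
        refine (mutualEnergy_mono hle hle).trans ?_
        rw [mutualEnergy_const_mul (by finiteness) (by finiteness)]
        gcongr
        exact mutualEnergy_cellDensity_le_two_mul m z z
    _ = ((m + 1 : ℝ≥0∞)⁻¹ * (m + 1)) * ((m + 1 : ℝ≥0∞)⁻¹ * (2 * G ^ 2)) := by ring
    _ = (m + 1 : ℝ≥0∞)⁻¹ * (2 * G ^ 2) := by rw [hinv, one_mul]

theorem weightedCell_mem_stepDensity (m : ℕ) {g : ℝ → ℕ} (hg : ∀ x, g x ≠ 0 → x ∈ Ico (0 : ℝ) 1)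
    (z : ℝ) : weightedCell m g z ∈ stepDensity := by
  by_cases hz : g z = 0
  · convert zero_mem stepDensity using 1
    ext x
    simp [weightedCell, hz]
  · convert natCast_mul_inv_mul_cellDensity_mem_stepDensity (g z) m m (hg z hz) using 1
    exact funext fun x => mul_left_comm _ _ _

/-- The superposition of the weighted cells around the points `c k`, for `k` in the block `s`. -/
noncomputable def blockDensity (s : Finset ℕ) (m : ℕ → ℕ) (g : ℝ → ℕ) (c : ℕ → ℝ) (x : ℝ) :
    ℝ≥0∞ :=
  ∑ k ∈ s, weightedCell (m k) g (c k) x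

theorem blockDensity_mem_stepDensity (s : Finset ℕ) (m : ℕ → ℕ) {g : ℝ → ℕ}
    (hg : ∀ x, g x ≠ 0 → x ∈ Ico (0 : ℝ) 1) (c : ℕ → ℝ) : blockDensity s m g c ∈ stepDensity := by
  convert sum_mem fun k (_ : k ∈ s) => weightedCell_mem_stepDensity (m k) hg (c k) using 1
  ext x
  simp [blockDensity]

theorem lintegral_blockDensity (s : Finset ℕ) (m : ℕ → ℕ) {g : ℝ → ℕ} (hg : Measurable g)
    (c : ℕ → ℝ) : ∫⁻ x, blockDensity s m g c x = ∑ k ∈ s, (m k + 1 : ℝ≥0∞)⁻¹ * g (c k) := by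
  unfold blockDensity
  rw [lintegral_finsetSum _ fun k _ => (measurable_uncurry_weightedCell _ hg).of_uncurry_left]
  simp only [lintegral_weightedCell]

theorem exists_of_blockDensity_ne_zero {s : Finset ℕ} {m : ℕ → ℕ} {g : ℝ → ℕ} {c : ℕ → ℝ} {x : ℝ}
    (hx : blockDensity s m g c x ≠ 0) :
    ∃ k ∈ s, g (c k) ≠ 0 ∧ dyadicIndex (m k) (c k) = dyadicIndex (m k) x := by
  obtain ⟨k, hk, hne⟩ := Finset.exists_ne_zero_of_sum_ne_zero hx
  refine ⟨k, hk, fun h0 => hne (by simp [weightedCell, h0]),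
    dyadicIndex_eq_of_cellDensity_ne_zero fun h0 => hne (by simp [weightedCell, h0])⟩

theorem tsupport_blockDensity_subset (s : Finset ℕ) {m : ℕ → ℕ} (g : ℝ → ℕ) {c l : ℕ → ℝ}
    (hl : ∀ k, (1 / 2 : ℝ) ^ m k < l k / 2) :
    tsupport (blockDensity s m g c) ⊆ ⋃ k ∈ s, Ioo (c k - l k / 2) (c k + l k / 2) := by
  have hclosed : IsClosed (⋃ k ∈ s, Metric.closedBall (c k) ((1 / 2) ^ m k)) :=
    s.finite_toSet.isClosed_biUnion fun k _ => Metric.isClosed_closedBall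
  refine (closure_minimal (fun x hx => ?_) hclosed).trans (iUnion₂_mono fun k _ x hx => ?_)
  · obtain ⟨k, hk, -, hkx⟩ := exists_of_blockDensity_ne_zero hx
    exact mem_biUnion hk (abs_sub_lt_of_dyadicIndex_eq hkx.symm).le
  · rw [Metric.mem_closedBall, Real.dist_eq, abs_le] at hx
    constructor <;> linarith [hl k, hx.1, hx.2]

section Expectation

variable {Ω : Type*} [MeasurableSpace Ω] {P : Measure Ω} {c : ℕ → Ω → ℝ}

theorem measurable_uncurry_blockDensity {s : Finset ℕ} (hc : ∀ k ∈ s, Measurable (c k))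
    (m : ℕ → ℕ) {g : ℝ → ℕ} (hg : Measurable g) :
    Measurable (Function.uncurry fun ω => blockDensity s m g fun k => c k ω) :=
  Finset.measurable_fun_sum _ fun k hk => (measurable_uncurry_weightedCell (m k) hg).comp
    (((hc k hk).comp measurable_fst).prodMk measurable_snd)

theorem lintegral_mutualEnergy_of_indepFun {S T : Type*} [MeasurableSpace S] [MeasurableSpace T]
    [IsFiniteMeasure P] {X : Ω → S} {Y : Ω → T} (hX : Measurable X) (hY : Measurable Y)
    (hXY : IndepFun X Y P) {U : S → ℝ → ℝ≥0∞} {V : T → ℝ → ℝ≥0∞}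
    (hU : Measurable (Function.uncurry U)) (hV : Measurable (Function.uncurry V)) :
    ∫⁻ ω, mutualEnergy (U (X ω)) (V (Y ω)) ∂P =
      mutualEnergy (fun x => ∫⁻ ω, U (X ω) x ∂P) (fun y => ∫⁻ ω, V (Y ω) y ∂P) := by
  have hE : Measurable fun p : S × T => mutualEnergy (U p.1) (V p.2) :=
    measurable_mutualEnergy
      (hU.comp (f := fun z : (S × T) × ℝ => (z.1.1, z.2)) (by fun_prop))
      (hV.comp (f := fun z : (S × T) × ℝ => (z.1.2, z.2)) (by fun_prop))
  calc ∫⁻ ω, mutualEnergy (U (X ω)) (V (Y ω)) ∂P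
      = ∫⁻ p, mutualEnergy (U p.1) (V p.2) ∂((P.map X).prod (P.map Y)) := by
        rw [← hXY.map_prod_eq_prod_map_map hX.aemeasurable hY.aemeasurable,
          lintegral_map hE (hX.prodMk hY)]
    _ = mutualEnergy (fun x => ∫⁻ a, U a x ∂(P.map X)) (fun y => ∫⁻ b, V b y ∂(P.map Y)) := by
        rw [lintegral_prod _ hE.aemeasurable, lintegral_lintegral_mutualEnergy hU hV]
    _ = mutualEnergy (fun x => ∫⁻ ω, U (X ω) x ∂P) (fun y => ∫⁻ ω, V (Y ω) y ∂P) := by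
        congr 1 with x
        · exact lintegral_map (hU.comp measurable_prodMk_right) hX
        · exact lintegral_map (hV.comp measurable_prodMk_right) hY

theorem lintegral_mutualEnergy_weightedCell_le [IsProbabilityMeasure P]
    (hc : ∀ k, Measurable (c k)) (hindep : iIndepFun c P) {m : ℕ → ℕ} {g : ℝ → ℕ}
    (hg : Measurable g) {G : ℕ} (hG : ∀ x, g x ≤ G) {H : ℝ → ℝ≥0∞} {j k : ℕ}
    (hHj : ∀ x, ∫⁻ ω, g (c j ω) * cellDensity (m j) (c j ω) x ∂P ≤ H x)
    (hHk : ∀ x, ∫⁻ ω, g (c k ω) * cellDensity (m k) (c k ω) x ∂P ≤ H x) :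
    ∫⁻ ω, mutualEnergy (weightedCell (m j) g (c j ω)) (weightedCell (m k) g (c k ω)) ∂P ≤
      (m j + 1 : ℝ≥0∞)⁻¹ * (m k + 1 : ℝ≥0∞)⁻¹ * mutualEnergy H H +
        if j = k then (m k + 1 : ℝ≥0∞)⁻¹ * (2 * G ^ 2) else 0 := by
  split_ifs with hjk
  · subst hjk
    refine le_add_left ((lintegral_mono fun ω => mutualEnergy_weightedCell_le _ hG _).trans_eq ?_)
    simp
  · rw [add_zero, ← mutualEnergy_const_mul (by finiteness) (by finiteness),
      lintegral_mutualEnergy_of_indepFun (hc j) (hc k) (hindep.indepFun hjk)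
        (measurable_uncurry_weightedCell _ hg) (measurable_uncurry_weightedCell _ hg)]
    refine mutualEnergy_mono (fun x => ?_) fun y => ?_
    all_goals
      simp only [weightedCell]
      rw [lintegral_const_mul' _ _ (by finiteness)]
      gcongr
    exacts [hHj x, hHk y]

theorem lintegral_mutualEnergy_blockDensity_le [IsProbabilityMeasure P]
    (hc : ∀ k, Measurable (c k)) (hindep : iIndepFun c P) {m : ℕ → ℕ} {g : ℝ → ℕ}
    (hg : Measurable g) {G : ℕ} (hG : ∀ x, g x ≤ G) {H : ℝ → ℝ≥0∞} {s : Finset ℕ}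
    (hH : ∀ k ∈ s, ∀ x, ∫⁻ ω, g (c k ω) * cellDensity (m k) (c k ω) x ∂P ≤ H x) :
    ∫⁻ ω, mutualEnergy (blockDensity s m g fun k => c k ω)
        (blockDensity s m g fun k => c k ω) ∂P ≤
      (∑ k ∈ s, (m k + 1 : ℝ≥0∞)⁻¹) ^ 2 * mutualEnergy H H +
        (∑ k ∈ s, (m k + 1 : ℝ≥0∞)⁻¹) * (2 * G ^ 2) := by
  have hcell : ∀ k, Measurable (Function.uncurry fun ω => weightedCell (m k) g (c k ω)) :=
    fun k => (measurable_uncurry_weightedCell (m k) hg).comp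
      (((hc k).comp measurable_fst).prodMk measurable_snd)
  calc ∫⁻ ω, mutualEnergy (blockDensity s m g fun k => c k ω)
        (blockDensity s m g fun k => c k ω) ∂P
      = ∫⁻ ω, ∑ j ∈ s, ∑ k ∈ s,
          mutualEnergy (weightedCell (m j) g (c j ω)) (weightedCell (m k) g (c k ω)) ∂P :=
        lintegral_congr fun ω => mutualEnergy_sum (fun j _ => (hcell j).of_uncurry_left)
          fun k _ => (hcell k).of_uncurry_left
    _ = ∑ j ∈ s, ∑ k ∈ s, ∫⁻ ω,
          mutualEnergy (weightedCell (m j) g (c j ω)) (weightedCell (m k) g (c k ω)) ∂P := by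
        rw [lintegral_finsetSum _ fun j _ => Finset.measurable_fun_sum _ fun k _ =>
          measurable_mutualEnergy (hcell j) (hcell k)]
        exact Finset.sum_congr rfl fun j _ => lintegral_finsetSum _ fun k _ =>
          measurable_mutualEnergy (hcell j) (hcell k)
    _ ≤ ∑ j ∈ s, ∑ k ∈ s, ((m j + 1 : ℝ≥0∞)⁻¹ * (m k + 1 : ℝ≥0∞)⁻¹ * mutualEnergy H H +
          if j = k then (m k + 1 : ℝ≥0∞)⁻¹ * (2 * G ^ 2) else 0) :=
        Finset.sum_le_sum fun j hj => Finset.sum_le_sum fun k hk =>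
          lintegral_mutualEnergy_weightedCell_le hc hindep hg hG (hH j hj) (hH k hk)
    _ = (∑ k ∈ s, (m k + 1 : ℝ≥0∞)⁻¹) ^ 2 * mutualEnergy H H +
          (∑ k ∈ s, (m k + 1 : ℝ≥0∞)⁻¹) * (2 * G ^ 2) := by
        simp only [Finset.sum_add_distrib, Finset.sum_ite_eq]
        congr 1
        · rw [sq, Finset.sum_mul_sum]
          simp only [Finset.sum_mul]
        · rw [Finset.sum_mul]
          exact Finset.sum_congr rfl fun j hj => if_pos hj

theorem sq_lintegral_le [IsProbabilityMeasure P] {X : Ω → ℝ≥0∞} (hX : Measurable X) :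
    (∫⁻ ω, X ω ∂P) ^ 2 ≤ ∫⁻ ω, X ω ^ 2 ∂P := by
  have h := eLpNorm'_le_eLpNorm'_of_exponent_le one_pos one_le_two P hX.aestronglyMeasurable
  simp only [eLpNorm', enorm_eq_self, ENNReal.rpow_one, div_one, ENNReal.rpow_two] at h
  calc (∫⁻ ω, X ω ∂P) ^ 2 ≤ ((∫⁻ ω, X ω ^ 2 ∂P) ^ (1 / 2 : ℝ)) ^ 2 := by gcongr
    _ = ∫⁻ ω, X ω ^ 2 ∂P := by
      rw [← ENNReal.rpow_two, ← ENNReal.rpow_mul, one_div_mul_cancel two_ne_zero, ENNReal.rpow_one]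

theorem mul_sq_lintegral_le_add_measure_lt [IsProbabilityMeasure P] {D X : Ω → ℝ≥0∞}
    (hD : Measurable D) (hX : Measurable X) {t B : ℝ≥0∞} (ht : t ≠ ⊤) (hB : ∀ ω, X ω ≤ B) :
    t * (∫⁻ ω, X ω ∂P) ^ 2 ≤ ∫⁻ ω, D ω ∂P + t * B ^ 2 * P {ω | D ω < t * X ω ^ 2} := by
  have hA : MeasurableSet {ω | D ω < t * X ω ^ 2} := measurableSet_lt hD (by fun_prop)
  calc t * (∫⁻ ω, X ω ∂P) ^ 2 ≤ t * ∫⁻ ω, X ω ^ 2 ∂P := by gcongr; exact sq_lintegral_le hX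
    _ = ∫⁻ ω, t * X ω ^ 2 ∂P := (lintegral_const_mul' _ _ ht).symm
    _ ≤ ∫⁻ ω, (D ω + {ω | D ω < t * X ω ^ 2}.indicator (fun _ => t * B ^ 2) ω) ∂P := by
      refine lintegral_mono fun ω => ?_
      by_cases hω : D ω < t * X ω ^ 2
      · rw [indicator_of_mem (s := {ω | D ω < t * X ω ^ 2}) hω]
        refine le_add_left ?_
        gcongr
        exact hB ω
      · exact le_add_right (not_lt.1 hω)
    _ = ∫⁻ ω, D ω ∂P + t * B ^ 2 * P {ω | D ω < t * X ω ^ 2} := by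
      rw [lintegral_add_left hD, lintegral_indicator_const hA]

end Expectation

/-! ### Independent blocks -/

theorem exists_pairwise_disjoint_le_sum {w : ℕ → ℝ≥0∞} (hw : ∀ k, w k ≠ ⊤) (hsum : ∑' k, w k = ⊤)
    {W : ℝ≥0∞} (hW : W ≠ ⊤) (r : ℕ) :
    ∃ s : ℕ → Finset ℕ, Pairwise (Function.onFun Disjoint s) ∧ (∀ i, W ≤ ∑ k ∈ s i, w k) ∧
      ∀ i, ∀ k ∈ s i, i ≤ k ∧ r ≤ k := by
  have hstep : ∀ N, ∃ M > N, W ≤ ∑ k ∈ Finset.Ico N M, w k := by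
    intro N
    have hlim := ENNReal.tendsto_nat_tsum w
    rw [hsum] at hlim
    have hfin : W + ∑ k ∈ Finset.range N, w k ≠ ⊤ :=
      ENNReal.add_ne_top.2 ⟨hW, ENNReal.sum_ne_top.2 fun k _ => hw k⟩
    obtain ⟨M, hM, hNM⟩ := ((hlim.eventually_const_lt hfin.lt_top).and
      (eventually_gt_atTop N)).exists
    refine ⟨M, hNM, ?_⟩
    rw [← Finset.sum_range_add_sum_Ico w hNM.le, add_comm] at hM
    exact (ENNReal.add_le_add_iff_left (ENNReal.sum_ne_top.2 fun k _ => hw k)).1 hM.le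
  choose next hlt hle using hstep
  have hN : StrictMono fun i => next^[i] r := strictMono_nat_of_lt_succ fun i => by
    simpa only [Function.iterate_succ_apply'] using hlt _
  refine ⟨fun i => Finset.Ico (next^[i] r) (next^[i + 1] r), ?_, fun i => ?_, fun i k hk => ?_⟩
  · intro i j hij
    rw [Function.onFun, ← Finset.disjoint_coe, Finset.coe_Ico, Finset.coe_Ico]
    exact hN.monotone.pairwise_disjoint_on_Ico_succ hij
  · simpa only [Function.iterate_succ_apply'] using hle _
  · have hk' := (Finset.mem_Ico.1 hk).1
    exact ⟨(hN.le_apply (x := i)).trans hk', (hN.monotone (Nat.zero_le i)).trans hk'⟩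

theorem iIndepSet_of_pairwise_disjoint {Ω ι κ : Type*} {mΩ : MeasurableSpace Ω} {P : Measure Ω}
    {m : ι → MeasurableSpace Ω} (hle : ∀ i, m i ≤ mΩ) (hm : iIndep m P)
    {s : κ → Set ι} (hs : Pairwise (Function.onFun Disjoint s)) {A : κ → Set Ω}
    (hA : ∀ i, MeasurableSet[⨆ k ∈ s i, m k] (A i)) : iIndepSet A P := by
  classical
  have := hm.isProbabilityMeasure
  rw [iIndepSet_iff_meas_biInter fun i => iSup₂_le (fun k _ => hle k) _ (hA i)]
  intro F
  induction F using Finset.induction_on with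
  | empty => simp
  | insert a F ha ih =>
    have hdisj : Disjoint (s a) (⋃ i ∈ F, s i) :=
      disjoint_iUnion₂_right.2 fun i hi => hs fun h => ha (h ▸ hi)
    have hsup : ∀ i ∈ F, ⨆ k ∈ s i, m k ≤ ⨆ k ∈ ⋃ i ∈ F, s i, m k := fun i hi =>
      biSup_mono fun k hk => mem_biUnion hi hk
    have hF : MeasurableSet[⨆ k ∈ ⋃ i ∈ F, s i, m k] (⋂ i ∈ F, A i) :=
      MeasurableSet.biInter F.countable_toSet fun i hi => hsup i hi _ (hA i)
    rw [Finset.set_biInter_insert, Finset.prod_insert ha, ← ih]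
    exact (Indep_iff _ _ _).1 (indep_iSup_of_disjoint hle hm hdisj) _ _ (hA a) hF

section RandomBlocks

variable {Ω : Type*} [MeasurableSpace Ω] {P : Measure Ω} {c : ℕ → Ω → ℝ}

/-- The event that the superposition over the block `s` has energy less than `t` times its squared
mass. -/
def blockEvent (s : Finset ℕ) (m : ℕ → ℕ) (g : ℝ → ℕ) (t : ℝ≥0∞) (c : ℕ → Ω → ℝ) : Set Ω :=
  {ω | mutualEnergy (blockDensity s m g fun k => c k ω) (blockDensity s m g fun k => c k ω) <
    t * (∫⁻ x, blockDensity s m g (fun k => c k ω) x) ^ 2}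

theorem measurable_mutualEnergy_blockDensity {s : Finset ℕ} (hc : ∀ k ∈ s, Measurable (c k))
    (m : ℕ → ℕ) {g : ℝ → ℕ} (hg : Measurable g) :
    Measurable fun ω =>
      mutualEnergy (blockDensity s m g fun k => c k ω) (blockDensity s m g fun k => c k ω) :=
  measurable_mutualEnergy (measurable_uncurry_blockDensity hc m hg)
    (measurable_uncurry_blockDensity hc m hg)

theorem measurable_lintegral_blockDensity {s : Finset ℕ} (hc : ∀ k ∈ s, Measurable (c k))
    (m : ℕ → ℕ) {g : ℝ → ℕ} (hg : Measurable g) :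
    Measurable fun ω => ∫⁻ x, blockDensity s m g (fun k => c k ω) x :=
  (measurable_uncurry_blockDensity hc m hg).lintegral_prod_right

theorem measurableSet_blockEvent {s : Finset ℕ} (hc : ∀ k ∈ s, Measurable (c k)) (m : ℕ → ℕ)
    {g : ℝ → ℕ} (hg : Measurable g) (t : ℝ≥0∞) : MeasurableSet (blockEvent s m g t c) :=
  measurableSet_lt (measurable_mutualEnergy_blockDensity hc m hg)
    (((measurable_lintegral_blockDensity hc m hg).pow_const 2).const_mul _)

theorem mul_sq_le_add_measure_blockEvent [IsProbabilityMeasure P] (hc : ∀ k, Measurable (c k))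
    (hindep : iIndepFun c P) {m : ℕ → ℕ} {g : ℝ → ℕ} (hg : Measurable g) {G : ℕ}
    (hG : ∀ x, g x ≤ G) {a : ℝ≥0∞} (ha : ∀ k, ∫⁻ ω, g (c k ω) ∂P = a) {H : ℝ → ℝ≥0∞}
    {t : ℝ≥0∞} (ht : t ≠ ⊤) {s : Finset ℕ}
    (hH : ∀ k ∈ s, ∀ x, ∫⁻ ω, g (c k ω) * cellDensity (m k) (c k ω) x ∂P ≤ H x) {W : ℝ≥0∞}
    (hW : W = ∑ k ∈ s, (m k + 1 : ℝ≥0∞)⁻¹) :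
    W ^ 2 * (t * a ^ 2) ≤ W ^ 2 * mutualEnergy H H + W * (2 * G ^ 2) +
      W ^ 2 * (t * G ^ 2 * P (blockEvent s m g t c)) := by
  have hmean : ∫⁻ ω, (∫⁻ x, blockDensity s m g (fun k => c k ω) x) ∂P = W * a := by
    have hgc : ∀ k, Measurable fun ω => (g (c k ω) : ℝ≥0∞) := fun k =>
      (measurable_of_countable (Nat.cast : ℕ → ℝ≥0∞)).comp (hg.comp (hc k))
    simp only [lintegral_blockDensity s m hg]
    rw [lintegral_finsetSum _ fun k _ => (hgc k).const_mul _, hW, Finset.sum_mul]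
    refine Finset.sum_congr rfl fun k _ => ?_
    rw [lintegral_const_mul' _ _ (by finiteness), ha]
  have hbound : ∀ ω, ∫⁻ x, blockDensity s m g (fun k => c k ω) x ≤ W * G := fun ω => by
    rw [lintegral_blockDensity s m hg, hW, Finset.sum_mul]
    gcongr
    exact hG _
  calc W ^ 2 * (t * a ^ 2)
      = t * (∫⁻ ω, (∫⁻ x, blockDensity s m g (fun k => c k ω) x) ∂P) ^ 2 := by rw [hmean]; ring
    _ ≤ ∫⁻ ω, mutualEnergy (blockDensity s m g fun k => c k ω)
          (blockDensity s m g fun k => c k ω) ∂P +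
        t * (W * G) ^ 2 * P (blockEvent s m g t c) :=
      mul_sq_lintegral_le_add_measure_lt
        (measurable_mutualEnergy_blockDensity (fun k _ => hc k) m hg)
        (measurable_lintegral_blockDensity (fun k _ => hc k) m hg) ht hbound
    _ ≤ W ^ 2 * mutualEnergy H H + W * (2 * G ^ 2) +
        t * (W * G) ^ 2 * P (blockEvent s m g t c) := by
      gcongr
      rw [hW]
      exact lintegral_mutualEnergy_blockDensity_le hc hindep hg hG hH
    _ = W ^ 2 * mutualEnergy H H + W * (2 * G ^ 2) +
        W ^ 2 * (t * G ^ 2 * P (blockEvent s m g t c)) := by ring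

theorem exists_forall_le_measure_blockEvent [IsProbabilityMeasure P] (hc : ∀ k, Measurable (c k))
    (hindep : iIndepFun c P) (m : ℕ → ℕ) {g : ℝ → ℕ} (hg : Measurable g) {G : ℕ}
    (hG : ∀ x, g x ≤ G) {a : ℝ≥0∞} (ha : ∀ k, ∫⁻ ω, g (c k ω) ∂P = a) {H : ℝ → ℝ≥0∞}
    {t : ℝ≥0∞} (ht : t ≠ ⊤) (hlt : mutualEnergy H H < t * a ^ 2) :
    ∃ p ≠ 0, ∃ W ≠ ⊤, ∀ s : Finset ℕ,
      (∀ k ∈ s, ∀ x, ∫⁻ ω, g (c k ω) * cellDensity (m k) (c k ω) x ∂P ≤ H x) →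
      W ≤ ∑ k ∈ s, (m k + 1 : ℝ≥0∞)⁻¹ → p ≤ P (blockEvent s m g t c) := by
  obtain ⟨d, hHd, hda⟩ := exists_between hlt
  have hgap : d - mutualEnergy H H ≠ 0 := (tsub_pos_of_lt hHd).ne'
  refine ⟨(t * a ^ 2 - d) / (t * G ^ 2 + 1),
    ENNReal.div_ne_zero.2 ⟨(tsub_pos_of_lt hda).ne', by finiteness⟩,
    2 * G ^ 2 / (d - mutualEnergy H H) + 1,
    ENNReal.add_ne_top.2 ⟨ENNReal.div_ne_top (by finiteness) hgap, by finiteness⟩,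
    fun s hH hs => ?_⟩
  set W := ∑ k ∈ s, (m k + 1 : ℝ≥0∞)⁻¹ with hW
  have hW0 : W ≠ 0 := (one_pos.trans_le (le_add_self.trans hs)).ne'
  have hWtop : W ≠ ⊤ := ENNReal.sum_ne_top.2 fun k _ => by finiteness
  have hdiag : 2 * G ^ 2 ≤ W * (d - mutualEnergy H H) :=
    (ENNReal.div_le_iff_le_mul (Or.inl hgap)
      (Or.inl (ne_top_of_le_ne_top hda.ne_top tsub_le_self))).1 (le_self_add.trans hs)
  have hmain : W ^ 2 * (t * a ^ 2) ≤ W ^ 2 * (d + t * G ^ 2 * P (blockEvent s m g t c)) :=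
    calc W ^ 2 * (t * a ^ 2)
        ≤ W ^ 2 * mutualEnergy H H + W * (W * (d - mutualEnergy H H)) +
          W ^ 2 * (t * G ^ 2 * P (blockEvent s m g t c)) :=
        (mul_sq_le_add_measure_blockEvent hc hindep hg hG ha ht hH hW).trans (by gcongr)
      _ = W ^ 2 * ((mutualEnergy H H + (d - mutualEnergy H H)) +
          t * G ^ 2 * P (blockEvent s m g t c)) := by ring
      _ = W ^ 2 * (d + t * G ^ 2 * P (blockEvent s m g t c)) := by
        rw [add_tsub_cancel_of_le hHd.le]
  rw [ENNReal.mul_le_mul_iff_right (by positivity) (by finiteness)] at hmain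
  refine ENNReal.div_le_of_le_mul (tsub_le_iff_left.2 (hmain.trans ?_))
  rw [mul_comm (P _)]
  gcongr
  exact le_self_add

theorem ae_exists_mem_blockEvent [IsProbabilityMeasure P] (hc : ∀ k, Measurable (c k))
    (hindep : iIndepFun c P) {m : ℕ → ℕ} (hm : ∑' k, (m k + 1 : ℝ≥0∞)⁻¹ = ⊤) {g : ℝ → ℕ}
    (hg : Measurable g) {G : ℕ} (hG : ∀ x, g x ≤ G) {a : ℝ≥0∞}
    (ha : ∀ k, ∫⁻ ω, g (c k ω) ∂P = a) {H : ℝ → ℝ≥0∞} {r : ℕ}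
    (hH : ∀ k ≥ r, ∀ x, ∫⁻ ω, g (c k ω) * cellDensity (m k) (c k ω) x ∂P ≤ H x) {t : ℝ≥0∞}
    (ht : t ≠ ⊤) (hlt : mutualEnergy H H < t * a ^ 2) :
    ∀ᵐ ω ∂P, ∀ n, ∃ s : Finset ℕ, (∀ k ∈ s, n ≤ k) ∧ ω ∈ blockEvent s m g t c := by
  obtain ⟨p, hp, W, hW, hpW⟩ := exists_forall_le_measure_blockEvent hc hindep m hg hG ha ht hlt
  obtain ⟨s, hdisj, hsW, hs⟩ :=
    exists_pairwise_disjoint_le_sum (w := fun k => (m k + 1 : ℝ≥0∞)⁻¹) (by finiteness) hm hW r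
  have hmeas : ∀ i, MeasurableSet (blockEvent (s i) m g t c) := fun i =>
    measurableSet_blockEvent (fun k _ => hc k) m hg t
  have hindep' : iIndepSet (fun i => blockEvent (s i) m g t c) P := by
    refine iIndepSet_of_pairwise_disjoint (s := fun i => (s i : Set ℕ))
      (fun k => (hc k).comap_le) hindep (fun i j hij => Finset.disjoint_coe.2 (hdisj hij))
      fun i => @measurableSet_blockEvent Ω
        (⨆ k ∈ (s i : Set ℕ), MeasurableSpace.comap (c k) inferInstance) c (s i)
        (fun k hk => measurable_iff_comap_le.2 (le_iSup₂_of_le k hk le_rfl)) m g hg t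
  have hsum : ∑' i, P (blockEvent (s i) m g t c) = ⊤ := by
    rw [eq_top_iff, ← ENNReal.tsum_const_eq_top_of_ne_zero (α := ℕ) hp]
    exact ENNReal.tsum_le_tsum fun i => hpW (s i) (fun k hk => hH k (hs i k hk).2) (hsW i)
  have hlim : ∀ᵐ ω ∂P, ω ∈ limsup (fun i => blockEvent (s i) m g t c) atTop :=
    (prob_compl_eq_zero_iff (MeasurableSet.measurableSet_limsup hmeas)).2
      (measure_limsup_eq_one hmeas hindep' hsum)
  filter_upwards [hlim] with ω hω n
  rw [mem_limsup_iff_frequently_mem, frequently_atTop] at hω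
  obtain ⟨i, hi, hiω⟩ := hω n
  exact ⟨s i, fun k hk => hi.trans (hs i k hk).1, hiω⟩

end RandomBlocks

/-! ### Integer weights -/

/-- The integer part of `M * y`, truncated at `M ^ 2`. Dividing by `M` gives approximations of `y`
from below. -/
noncomputable def truncFloor (M : ℕ) (y : ℝ≥0∞) : ℕ :=
  ⌊(min (M * y) (M ^ 2)).toReal⌋₊

theorem measurable_truncFloor (M : ℕ) : Measurable (truncFloor M) := by
  unfold truncFloor
  fun_prop

theorem truncFloor_le_sq (M : ℕ) (y : ℝ≥0∞) : truncFloor M y ≤ M ^ 2 := by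
  have h : (truncFloor M y : ℝ≥0∞) ≤ M ^ 2 := (natCast_floor_toReal_le _).trans (min_le_right _ _)
  exact_mod_cast h

theorem truncFloor_le_mul (M : ℕ) (y : ℝ≥0∞) : (truncFloor M y : ℝ≥0∞) ≤ M * y :=
  (natCast_floor_toReal_le _).trans (min_le_left _ _)

theorem truncFloor_div_le (M : ℕ) (y : ℝ≥0∞) : (truncFloor M y : ℝ≥0∞) / M ≤ y :=
  ENNReal.div_le_of_le_mul ((truncFloor_le_mul M y).trans_eq (mul_comm _ _))

theorem tendsto_truncFloor_div {y : ℝ≥0∞} (hy : y ≠ ⊤) :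
    Tendsto (fun M : ℕ => (truncFloor M y : ℝ≥0∞) / M) atTop (𝓝 y) := by
  have hlim : Tendsto (fun M : ℕ => ENNReal.ofReal (⌊y.toReal * M⌋₊ / (M : ℝ))) atTop (𝓝 y) := by
    nth_rw 2 [← ENNReal.ofReal_toReal hy]
    exact ENNReal.tendsto_ofReal ((tendsto_nat_floor_mul_div_atTop
      ENNReal.toReal_nonneg).comp tendsto_natCast_atTop_atTop)
  refine hlim.congr' ?_
  obtain ⟨N, hN⟩ := ENNReal.exists_nat_gt hy
  filter_upwards [eventually_ge_atTop N, eventually_gt_atTop 0] with M hNM hM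
  have hyM : y ≤ M := hN.le.trans (by exact_mod_cast hNM)
  have hmin : min (M * y) ((M : ℝ≥0∞) ^ 2) = M * y :=
    min_eq_left (by rw [sq]; gcongr)
  rw [truncFloor, hmin, ENNReal.toReal_mul, ENNReal.toReal_natCast, mul_comm,
    ENNReal.ofReal_div_of_pos (by exact_mod_cast hM), ENNReal.ofReal_natCast,
    ENNReal.ofReal_natCast]

theorem tendsto_lintegral_truncFloor_div {X : Type*} [MeasurableSpace X] {μ : Measure X}
    {y : X → ℝ≥0∞} (hy : Measurable y) (hint : ∫⁻ x, y x ∂μ ≠ ⊤) :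
    Tendsto (fun M : ℕ => (∫⁻ x, truncFloor M (y x) ∂μ) / M) atTop (𝓝 (∫⁻ x, y x ∂μ)) := by
  have hmeas : ∀ M, Measurable fun x => (truncFloor M (y x) : ℝ≥0∞) := fun M =>
    (measurable_of_countable (Nat.cast : ℕ → ℝ≥0∞)).comp ((measurable_truncFloor M).comp hy)
  have hlim := tendsto_lintegral_of_dominated_convergence y
    (fun M => (hmeas M).div_const (M : ℝ≥0∞))
    (fun M => Eventually.of_forall fun x => truncFloor_div_le M (y x)) hint
    ((ae_lt_top hy hint).mono fun _ hx => tendsto_truncFloor_div hx.ne)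
  refine hlim.congr fun M => ?_
  simp only [div_eq_mul_inv]
  exact lintegral_mul_const _ (hmeas M)

theorem setLIntegral_Icc_of_mem_stepDensity {h : ℝ → ℝ≥0∞} (hh : h ∈ stepDensity) :
    ∫⁻ x in Icc (0 : ℝ) 1, h x = ∫⁻ x, h x :=
  setLIntegral_eq_of_support_subset fun _ hx =>
    Ico_subset_Icc_self (mem_Ico_of_mem_stepDensity hh hx)

/-- The weights are integers so that superpositions of cells stay in the countable class of step
densities. -/
theorem exists_nat_weight {π : Measure ℝ} [SigmaFinite π]
    (hπ : volume.restrict (Icc (0 : ℝ) 1) ≪ π) {h : ℝ → ℝ≥0∞} (hh : h ∈ stepDensity)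
    {t : ℝ≥0∞} (ht : t ≠ ⊤) (hlt : mutualEnergy h h < t * (∫⁻ x, h x) ^ 2) :
    ∃ (g : ℝ → ℕ) (M G : ℕ), Measurable g ∧ (∀ x, g x ≤ G) ∧ (∀ x, g x ≠ 0 → h x ≠ 0) ∧
      (∀ φ : ℝ → ℝ≥0∞, Measurable φ → ∫⁻ x, g x * φ x ∂π ≤ M * ∫⁻ x, h x * φ x) ∧
      mutualEnergy (fun x => M * h x) (fun x => M * h x) < t * (∫⁻ x, g x ∂π) ^ 2 := by
  have hhm := measurable_of_mem_stepDensity hh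
  set q := (volume.restrict (Icc (0 : ℝ) 1)).rnDeriv π
  have hqm : Measurable q := Measure.measurable_rnDeriv _ _
  have hqh : ∫⁻ x, q x * h x ∂π = ∫⁻ x, h x := by
    rw [lintegral_rnDeriv_mul hπ hhm.aemeasurable, setLIntegral_Icc_of_mem_stepDensity hh]
  have hlim := tendsto_lintegral_truncFloor_div (μ := π) (hqm.mul hhm)
    (by simpa only [Pi.mul_apply, hqh] using lintegral_ne_top_of_mem_stepDensity hh)
  simp only [Pi.mul_apply, hqh] at hlim
  obtain ⟨M, hM, hM0⟩ := (((ENNReal.Tendsto.const_mul (ENNReal.Tendsto.pow hlim)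
    (Or.inr ht)).eventually_const_lt hlt).and (eventually_gt_atTop 0)).exists
  have hM0' : (M : ℝ≥0∞) ≠ 0 := by exact_mod_cast hM0.ne'
  refine ⟨fun x => truncFloor M (q x * h x), M, M ^ 2, (measurable_truncFloor M).comp (hqm.mul hhm),
    fun x => truncFloor_le_sq M _, fun x hx h0 => hx (by simp [truncFloor, h0]), fun φ hφ => ?_, ?_⟩
  · calc ∫⁻ x, truncFloor M (q x * h x) * φ x ∂π ≤ ∫⁻ x, M * (q x * (h x * φ x)) ∂π := by
          refine lintegral_mono fun x => ?_
          rw [← mul_assoc (q x), ← mul_assoc]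
          gcongr
          exact truncFloor_le_mul M _
      _ = M * ∫⁻ x in Icc (0 : ℝ) 1, h x * φ x := by
          rw [lintegral_const_mul' _ _ (by finiteness),
            lintegral_rnDeriv_mul (f := fun x => h x * φ x) hπ (by fun_prop)]
      _ ≤ M * ∫⁻ x, h x * φ x := by
          gcongr
          exact Measure.restrict_le_self
  · rw [mutualEnergy_const_mul (by finiteness) (by finiteness)]
    calc (M : ℝ≥0∞) * M * mutualEnergy h h
        < M * M * (t * ((∫⁻ x, truncFloor M (q x * h x) ∂π) / M) ^ 2) :=
          ENNReal.mul_lt_mul_right (by positivity) (by finiteness) hM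
      _ = t * ((∫⁻ x, truncFloor M (q x * h x) ∂π) / M * M) ^ 2 := by ring
      _ = t * (∫⁻ x, truncFloor M (q x * h x) ∂π) ^ 2 := by
          rw [ENNReal.div_mul_cancel hM0' (by finiteness)]

theorem ae_exists_stepDensity {Ω : Type*} [MeasurableSpace Ω] {P : Measure Ω}
    [IsProbabilityMeasure P] {c : ℕ → Ω → ℝ} (hc : ∀ k, Measurable (c k)) (hindep : iIndepFun c P)
    {π : Measure ℝ} (hlaw : ∀ k, P.map (c k) = π) (hπ : volume.restrict (Icc (0 : ℝ) 1) ≪ π)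
    {l : ℕ → ℝ} {m : ℕ → ℕ} (hml : ∀ k, (1 / 2 : ℝ) ^ m k < l k / 2)
    (hm : Tendsto m atTop atTop) (hsum : ∑' k, (m k + 1 : ℝ≥0∞)⁻¹ = ⊤)
    {h : ℝ → ℝ≥0∞} (hh : h ∈ stepDensity) {t : ℝ≥0∞} (ht : t ≠ ⊤)
    (hlt : mutualEnergy h h < t * (∫⁻ x, h x) ^ 2) :
    ∀ᵐ ω ∂P, ∀ n, ∃ u ∈ stepDensity, mutualEnergy u u < t * (∫⁻ x, u x) ^ 2 ∧
      Function.support u ⊆ Function.support h ∧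
      tsupport u ⊆ ⋃ k ≥ n, Ioo (c k ω - l k / 2) (c k ω + l k / 2) := by
  have : IsProbabilityMeasure π := hlaw 0 ▸ Measure.isProbabilityMeasure_map (hc 0).aemeasurable
  have hmap : ∀ k {φ : ℝ → ℝ≥0∞}, Measurable φ → ∫⁻ ω, φ (c k ω) ∂P = ∫⁻ x, φ x ∂π :=
    fun k φ hφ => by rw [← hlaw k, lintegral_map hφ (hc k)]
  obtain ⟨g, M, G, hg, hG, hgh, hgM, hlt'⟩ := exists_nat_weight hπ hh ht hlt
  have hg' : Measurable fun x => (g x : ℝ≥0∞) :=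
    (measurable_of_countable (Nat.cast : ℕ → ℝ≥0∞)).comp hg
  obtain ⟨r₀, hr₀⟩ := exists_forall_eq_of_mem_stepDensity hh
  obtain ⟨r, hr⟩ := eventually_atTop.1 (hm.eventually_ge_atTop r₀)
  have hH : ∀ k ≥ r, ∀ x, ∫⁻ ω, g (c k ω) * cellDensity (m k) (c k ω) x ∂P ≤ M * h x := by
    intro k hk x
    rw [hmap k (φ := fun z => g z * cellDensity (m k) z x) (by fun_prop)]
    refine (hgM _ (by fun_prop)).trans_eq ?_
    rw [← lintegral_cellDensity_mul_eq (hr₀ _ (hr k hk)) x]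
    simp only [cellDensity_comm _ x, mul_comm]
  filter_upwards [ae_exists_mem_blockEvent hc hindep hsum hg hG (fun k => hmap k hg') hH ht hlt']
    with ω hω n
  obtain ⟨s, hs, hsω⟩ := hω (max n r)
  refine ⟨blockDensity s m g fun k => c k ω, blockDensity_mem_stepDensity s m
    (fun x hx => mem_Ico_of_mem_stepDensity hh (hgh x hx)) _, hsω, fun x hx => ?_,
    (tsupport_blockDensity_subset s g hml).trans <|
      biUnion_subset_biUnion_left fun k hk => (le_max_left n r).trans (hs k hk)⟩
  obtain ⟨k, hk, hgk, hkx⟩ := exists_of_blockDensity_ne_zero hx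
  rw [Function.mem_support, ← hr₀ _ (hr k ((le_max_right n r).trans (hs k hk))) _ _ hkx]
  exact hgh _ hgk

theorem exists_generation {l : ℕ → ℝ} (hl_pos : ∀ k, 0 < l k) (hl : Tendsto l atTop (𝓝 0))
    (hsum : ¬ Summable fun k => (Real.log (l k))⁻¹) :
    ∃ m : ℕ → ℕ, (∀ k, (1 / 2 : ℝ) ^ m k < l k / 2) ∧ Tendsto m atTop atTop ∧
      ∑' k, (m k + 1 : ℝ≥0∞)⁻¹ = ⊤ := by
  have hlog2 : 0 < Real.log 2 := Real.log_pos one_lt_two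
  have hlog : Tendsto (fun k => -Real.log (l k)) atTop atTop :=
    tendsto_neg_atBot_atTop.comp (Real.tendsto_log_nhdsGT_zero.comp
      (tendsto_nhdsWithin_iff.2 ⟨hl, Eventually.of_forall hl_pos⟩))
  refine ⟨fun k => ⌈-Real.log (l k) / Real.log 2⌉₊ + 2, fun k => ?_, ?_, ?_⟩
  · have hceil := Nat.le_ceil (-Real.log (l k) / Real.log 2)
    rw [div_le_iff₀ hlog2] at hceil
    rw [← Real.log_lt_log_iff (by positivity) (by linarith [hl_pos k]), Real.log_pow,
      Real.log_div (hl_pos k).ne' two_ne_zero, one_div, Real.log_inv]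
    push_cast
    linarith
  · exact (tendsto_add_atTop_nat 2).comp
      (tendsto_nat_ceil_atTop.comp (hlog.atTop_div_const hlog2))
  · by_contra hfin
    refine hsum (Summable.of_norm_bounded_eventually_nat
      ((ENNReal.summable_toReal hfin).mul_left 6) ?_)
    filter_upwards [hlog.eventually_ge_atTop 1] with k hk
    have hceil := (Nat.ceil_lt_add_one (a := -Real.log (l k) / Real.log 2) (by positivity)).le
    have hdiv : -Real.log (l k) / Real.log 2 ≤ 2 * -Real.log (l k) := by
      rw [div_le_iff₀ hlog2]
      nlinarith [Real.log_two_gt_d9]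
    rw [norm_inv, Real.norm_eq_abs, ← abs_neg, abs_of_pos (by linarith), ENNReal.toReal_inv,
      ENNReal.toReal_add (by finiteness) (by finiteness), ENNReal.toReal_natCast,
      ENNReal.toReal_one, ← div_eq_mul_inv, inv_le_comm₀ (by linarith) (by positivity), inv_div,
      div_le_iff₀ (by norm_num)]
    push_cast
    linarith

/-! ### The dichotomy -/

theorem ae_logCapacity_limsupIntervals_eq {Ω : Type*} [MeasurableSpace Ω] {P : Measure Ω}
    [IsProbabilityMeasure P] {c : ℕ → Ω → ℝ} (hc : ∀ k, Measurable (c k)) (hindep : iIndepFun c P)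
    {π : Measure ℝ} (hlaw : ∀ k, P.map (c k) = π) (hπ_mem : ∀ᵐ x ∂π, x ∈ Icc (0 : ℝ) 1)
    (hπ : volume.restrict (Icc (0 : ℝ) 1) ≪ π) {l : ℕ → ℝ} (hl_pos : ∀ k, 0 < l k)
    (hl : Tendsto l atTop (𝓝 0)) (hsum : ¬ Summable fun k => (Real.log (l k))⁻¹) :
    ∀ᵐ ω ∂P, logCapacity (((↑) : ℝ → ℂ) '' limsupIntervals (fun k => c k ω) l) =
      logCapacity (((↑) : ℝ → ℂ) '' Icc (0 : ℝ) 1) := by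
  obtain ⟨m, hml, hm, hmsum⟩ := exists_generation hl_pos hl hsum
  have hmem : ∀ᵐ ω ∂P, ∀ k, c k ω ∈ Icc (0 : ℝ) 1 := ae_all_iff.2 fun k =>
    ae_of_ae_map (p := (· ∈ Icc (0 : ℝ) 1)) (hc k).aemeasurable (hlaw k ▸ hπ_mem)
  have hstep : ∀ᵐ ω ∂P, ∀ q : ℚ, ∀ h ∈ (stepDensity : Set (ℝ → ℝ≥0∞)),
      mutualEnergy h h < ENNReal.ofReal q * (∫⁻ x, h x) ^ 2 →
      ∀ n, ∃ u ∈ stepDensity, mutualEnergy u u < ENNReal.ofReal q * (∫⁻ x, u x) ^ 2 ∧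
        Function.support u ⊆ Function.support h ∧
        tsupport u ⊆ ⋃ k ≥ n, Ioo (c k ω - l k / 2) (c k ω + l k / 2) := by
    refine ae_all_iff.2 fun q => (ae_ball_iff countable_stepDensity).2 fun h hh => ?_
    by_cases hlt : mutualEnergy h h < ENNReal.ofReal q * (∫⁻ x, h x) ^ 2
    · simpa only [hlt, true_imp_iff] using ae_exists_stepDensity hc hindep hlaw hπ hml hm hmsum hh
        ENNReal.ofReal_ne_top hlt
    · exact Eventually.of_forall fun ω hlt' => absurd hlt' hlt
  filter_upwards [hmem, hstep] with ω hωmem hωstep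
  exact le_antisymm
    (logCapacity_mono (image_mono (limsupIntervals_subset isClosed_Icc hωmem hl)))
    (logCapacity_Icc_le_limsupIntervals hωstep)

/-- The finitely many terms with `l k = 1` contribute `0⁻¹ = 0` to the series. -/
theorem mainTheorem2_general {Ω : Type*} [MeasurableSpace Ω] (P : Measure Ω)
    [IsProbabilityMeasure P] (c : ℕ → Ω → ℝ) (hc : ∀ k, Measurable (c k)) (hindep : iIndepFun c P)
    (π : Measure ℝ) (hlaw : ∀ k, P.map (c k) = π) (hπ_mem : ∀ᵐ x ∂π, x ∈ Icc (0 : ℝ) 1)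
    (hπ : volume.restrict (Icc (0 : ℝ) 1) ≪ π) (l : ℕ → ℝ) (hl_pos : ∀ k, 0 < l k)
    (hl : Tendsto l atTop (𝓝 0)) :
    ((¬ Summable fun k => (Real.log (l k))⁻¹) →
      (∀ᵐ ω ∂P, logCapacity (((↑) : ℝ → ℂ) '' limsupIntervals (fun k => c k ω) l) =
        logCapacity (((↑) : ℝ → ℂ) '' Icc (0 : ℝ) 1)) ∧
      0 < logCapacity (((↑) : ℝ → ℂ) '' Icc (0 : ℝ) 1)) ∧
    ((Summable fun k => (Real.log (l k))⁻¹) → ∀ ω,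
      logCapacity (((↑) : ℝ → ℂ) '' limsupIntervals (fun k => c k ω) l) = 0) :=
  ⟨fun hsum => ⟨ae_logCapacity_limsupIntervals_eq hc hindep hlaw hπ_mem hπ hl_pos hl hsum,
    logCapacity_Icc_pos⟩, fun hsum _ => logCapacity_limsupIntervals_eq_zero hl_pos hl hsum _⟩

theorem expLength_pos (Λ α : ℝ) (k : ℕ) : 0 < expLength Λ α k :=
  Real.exp_pos _

theorem tendsto_expLength {Λ α : ℝ} (hΛ : 0 < Λ) (hα : 0 < α) :
    Tendsto (expLength Λ α) atTop (𝓝 0) :=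
  Real.tendsto_exp_atBot.comp <| ((tendsto_rpow_atTop hα).comp
    tendsto_natCast_atTop_atTop).const_mul_atTop_of_neg (neg_neg_of_pos hΛ)

theorem summable_inv_log_expLength_iff {Λ α : ℝ} (hΛ : Λ ≠ 0) :
    (Summable fun k => (Real.log (expLength Λ α k))⁻¹) ↔ 1 < α := by
  simp only [expLength, Real.log_exp, mul_inv]
  rw [summable_mul_left_iff (inv_ne_zero (neg_ne_zero.2 hΛ)), Real.summable_nat_rpow_inv]

end

theorem mainTheorem2 {Ω : Type*} [MeasurableSpace Ω] (P : Measure Ω) [IsProbabilityMeasure P]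
    (c : ℕ → Ω → ℝ) (hc_meas : ∀ k, Measurable (c k)) (hc_indep : iIndepFun c P)
    (f : ℝ → ℝ) (hf_meas : Measurable f)
    (hf_pos : ∀ᵐ x ∂(volume.restrict (Icc (0 : ℝ) 1)), 0 < f x)
    (hf_bdd : ∃ K : ℝ, ∀ᵐ x ∂(volume.restrict (Icc (0 : ℝ) 1)), f x ≤ K)
    (hc_law : ∀ k, P.map (c k) =
      (volume.restrict (Icc (0 : ℝ) 1)).withDensity (fun x => ENNReal.ofReal (f x)))
    (Λ α : ℝ) (hΛ : 0 < Λ) (hα : 0 < α) :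
    (α ≤ 1 →
      (∀ᵐ ω ∂P,
        logCapacity (((↑) : ℝ → ℂ) '' limsupIntervals (fun k => c k ω) (expLength Λ α)) =
          logCapacity (((↑) : ℝ → ℂ) '' Icc (0 : ℝ) 1)) ∧
      0 < logCapacity (((↑) : ℝ → ℂ) '' Icc (0 : ℝ) 1)) ∧
    (1 < α → ∀ ω,
      logCapacity (((↑) : ℝ → ℂ) '' limsupIntervals (fun k => c k ω) (expLength Λ α)) = 0) := by
  have hmem := (withDensity_absolutelyContinuous (volume.restrict (Icc (0 : ℝ) 1))
    fun x => ENNReal.ofReal (f x)).ae_le (ae_restrict_mem measurableSet_Icc)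
  have hac := withDensity_absolutelyContinuous' (μ := volume.restrict (Icc (0 : ℝ) 1))
    hf_meas.ennreal_ofReal.aemeasurable (hf_pos.mono fun x hx => (ENNReal.ofReal_pos.2 hx).ne')
  simpa only [summable_inv_log_expLength_iff hΛ.ne', not_lt] using
    mainTheorem2_general P c hc_meas hc_indep _ hc_law hmem hac (expLength Λ α)
      (expLength_pos Λ α) (tendsto_expLength hΛ hα)
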